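/- Let $V\subset\mathbb C^N$ ($N\ge 1$) be an algebraic curve, i.e. the common zero set of finitely many polynomials such that, with $I=\mathbf I(V)\subset\mathbb C[z_1,\dots,z_N]$ the ideal of all polynomials vanishing on $V$, the dimension of the space of elements of $\mathbb C[z]/I$ having a representative of degree at most $s$ equals $as+b$ for all large $s$, where $a\ge 1$ and $b$ are integers. Let $V_{\mathbb P}\subset\mathbb{CP}^N$ be the projective closure of $V$ under $(z_1,\dots,z_N)\mapsto[1:z_1:\cdots:z_N]$ (the smallest projective variety containing the image of $V$), and let $H_\infty=\{z_0=0\}$. Order the monomials by grevlex: $z^\alpha\prec z^\beta$ if $|\alpha|<|\beta|$, or if $|\alpha|=|\beta|$ and $\alpha_i>\beta_i$ at the first index $i$ with $\alpha_i\neq\beta_i$. Let $\langle\mathrm{lt}(I)\rangle$ be the ideal generated by the leading terms of the elements of $I$, and let $\mathcal B$ be the set of monomials not in $\langle\mathrm{lt}(I)\rangle$. The normal form $\rho(p)$ of a polynomial $p$ is the unique linear combination of elements of $\mathcal B$ with $p-\rho(p)\in I$. Let $\mathbb C[V]_{=n}$ be the span of the monomials of degree $n$ in $\mathcal B$. For polynomials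 $p,q$ let $p\,\widehat{*}\,q$ be the leading homogeneous part of $\rho(pq)$ if $\deg\rho(pq)=\deg p+\deg q$, and $0$ otherwise. Then there is an integer $d\ge 1$ such that for all sufficiently large $n$ (depending only on $V$) one has $\dim\mathbb C[V]_{=n}=\dim\mathbb C[V]_{=n+1}=d$ and the following holds, where $[[z_j]]$ denotes the $d\times d$ matrix of the linear map $\mathbb C[V]_{=n}\to\mathbb C[V]_{=n+1}$, $q\mapsto z_j\,\widehat{*}\,q$, with respect to the bases of monomials of $\mathcal B$ of degree $n$ and $n+1$, each listed in increasing grevlex order. 1. For every $j\in\{2,\dots,N\}$ and every point $[0:1:\lambda_2:\cdots:\lambda_N]\in V_{\mathbb P}\cap H_\infty$, the number $\lambda_j$ is an eigenvalue of $[[z_j]]$. 2. Suppose that $z_1\neq 0$ at every point $[0:z_1:\cdots:z_N]\in V_{\mathbb P}\cap H_\infty$. Then for every $j\in\{2,\dots,N\}$ and $\lambda\in\mathbb C$: $\lambda$ is an eigenvalue of $[[z_j]]$ if and only if there is a point $[0:1:\lambda_2:\cdots:\lambda_N]\in V_{\mathbb P}\cap H_\infty$ with $\lambda_j=\lambda$.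 3. Suppose that every point $[0:z_1:\cdots:z_N]\in V_{\mathbb P}\cap H_\infty$ has $z_j\neq 0$ for all $j=1,\dots,N$. Then all the matrices $[[z_j]]$, $j=1,\dots,N$, are nonsingular. -/

import Mathlib

open MvPolynomial

noncomputable section

namespace CurveComputation

/-! ### The grevlex monomial order

The affine coordinates `z_1, …, z_N` are indexed by `Fin N`, so that `z_1` is `X 0`, and
`z_1 ≺ z_2 ≺ ⋯ ≺ z_N`. -/

/-- The strict grevlex order on multi-indices: compare total degrees, and break ties by
the first index at which the multi-indices differ, the larger exponent giving the smaller
monomial. -/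
def GrevlexLT {N : ℕ} (α β : Fin N →₀ ℕ) : Prop :=
  α.degree < β.degree ∨
    (α.degree = β.degree ∧ ∃ i, β i < α i ∧ ∀ j < i, α j = β j)

/-- Multi-indices, as a type synonym that carries the grevlex order. -/
def Grevlex (N : ℕ) : Type := Fin N →₀ ℕ

instance (N : ℕ) : AddCommMonoid (Grevlex N) := inferInstanceAs (AddCommMonoid (Fin N →₀ ℕ))

theorem GrevlexLT.irrefl {N : ℕ} (α : Fin N →₀ ℕ) : ¬ GrevlexLT α α := by
  rintro (h | ⟨-, i, h, -⟩) <;> exact lt_irrefl _ h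

theorem GrevlexLT.trans {N : ℕ} {α β γ : Fin N →₀ ℕ} (h₁ : GrevlexLT α β)
    (h₂ : GrevlexLT β γ) : GrevlexLT α γ := by
  rcases h₁ with h₁ | ⟨e₁, i, hi, hi'⟩
  · rcases h₂ with h₂ | ⟨e₂, -⟩
    · exact Or.inl (h₁.trans h₂)
    · exact Or.inl (e₂ ▸ h₁)
  · rcases h₂ with h₂ | ⟨e₂, k, hk, hk'⟩
    · exact Or.inl (e₁ ▸ h₂)
    · refine Or.inr ⟨e₁.trans e₂, ?_⟩
      rcases lt_trichotomy i k with h | h | h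
      · exact ⟨i, (hk' i h) ▸ hi, fun j hj => (hi' j hj).trans (hk' j (hj.trans h))⟩
      · subst h
        exact ⟨i, hk.trans hi, fun j hj => (hi' j hj).trans (hk' j hj)⟩
      · exact ⟨k, (hi' k h).symm ▸ hk, fun j hj => (hi' j (hj.trans h)).trans (hk' j hj)⟩

theorem GrevlexLT.trichotomy {N : ℕ} (α β : Fin N →₀ ℕ) :
    GrevlexLT α β ∨ α = β ∨ GrevlexLT β α := by
  rcases lt_trichotomy α.degree β.degree with h | h | h
  · exact Or.inl (Or.inl h)
  · by_cases hab : α = β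
    · exact Or.inr (Or.inl hab)
    · have hne : (Finset.univ.filter fun i => α i ≠ β i).Nonempty := by
        by_contra hcon
        rw [Finset.not_nonempty_iff_eq_empty, Finset.filter_eq_empty_iff] at hcon
        exact hab (Finsupp.ext fun i => not_not.mp (hcon (Finset.mem_univ i)))
      set i := (Finset.univ.filter fun i => α i ≠ β i).min' hne with hi
      have hi1 : α i ≠ β i :=
        (Finset.mem_filter.mp (Finset.min'_mem _ hne)).2
      have hi2 : ∀ j < i, α j = β j := by
        intro j hj
        by_contra hcon
        exact absurd (Finset.min'_le (Finset.univ.filter fun i => α i ≠ β i) j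
          (Finset.mem_filter.mpr ⟨Finset.mem_univ _, hcon⟩)) (not_le.mpr hj)
      rcases lt_or_gt_of_ne hi1 with h1 | h1
      · exact Or.inr (Or.inr (Or.inr ⟨h.symm, i, h1, fun j hj => (hi2 j hj).symm⟩))
      · exact Or.inl (Or.inr ⟨h, i, h1, hi2⟩)
  · exact Or.inr (Or.inr (Or.inl h))

theorem GrevlexLT.add_left {N : ℕ} {α β : Fin N →₀ ℕ} (h : GrevlexLT α β) (γ : Fin N →₀ ℕ) :
    GrevlexLT (γ + α) (γ + β) := by
  rcases h with h | ⟨e, i, hi, hi'⟩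
  · exact Or.inl (by simpa [map_add] using h)
  · exact Or.inr ⟨by simpa [map_add] using e, i, by simpa using hi,
      fun j hj => by simpa using hi' j hj⟩

instance (N : ℕ) : LT (Grevlex N) := ⟨fun α β => GrevlexLT (N := N) α β⟩

instance (N : ℕ) : IsStrictTotalOrder (Grevlex N) (· < ·) where
  irrefl α := GrevlexLT.irrefl α
  trans _ _ _ h₁ h₂ := GrevlexLT.trans h₁ h₂
  trichotomous α β h₁ h₂ := by
    rcases GrevlexLT.trichotomy (N := N) α β with h | h | h
    · exact absurd h h₁
    · exact h
    · exact absurd h h₂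

open Classical in
instance (N : ℕ) : LinearOrder (Grevlex N) := linearOrderOfSTO (α := Grevlex N) (· < ·)

instance (N : ℕ) : IsOrderedAddMonoid (Grevlex N) where
  add_le_add_left α β h γ := by
    rcases eq_or_lt_of_le h with h | h
    · rw [h]
    · refine le_of_lt ?_
      rw [add_comm α γ, add_comm β γ]
      exact GrevlexLT.add_left (N := N) h γ

instance (N : ℕ) : WellFoundedLT (Grevlex N) := by
  have hfin : ∀ α : Grevlex N, (Set.Iio α).Finite := by
    intro α
    refine Set.Finite.subset (Finsupp.finite_of_degree_le (σ := Fin N)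
      (Finsupp.degree (α : Fin N →₀ ℕ))) ?_
    intro β hβ
    rcases (show GrevlexLT (N := N) β α from hβ) with h | ⟨h, -⟩
    · exact h.le
    · exact h.le
  refine StrictMono.wellFoundedLT (f := fun α : Grevlex N => (Set.Iio α).ncard) ?_
  intro α β h
  exact Set.ncard_lt_ncard (Set.Iio_ssubset_Iio h) (hfin β)

/-- The grevlex order as a monomial order. -/
def grevlex (N : ℕ) : MonomialOrder (Fin N) where
  syn := Grevlex N
  toSyn :=
    { toFun := fun α => α
      invFun := fun α => α
      left_inv := fun _ => rfl
      right_inv := fun _ => rfl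
      map_add' := fun _ _ => rfl }
  toSyn_monotone α β h := by
    by_cases e : α = β
    · rw [e]
    · refine le_of_lt (show GrevlexLT α β from Or.inl ?_)
      obtain ⟨γ, rfl⟩ := exists_add_of_le h
      have hγ : γ ≠ 0 := by
        rintro rfl
        simp at e
      have : γ.degree ≠ 0 := fun h0 => hγ ((Finsupp.degree_eq_zero_iff γ).mp h0)
      rw [map_add]
      omega

theorem grevlex_lt_iff {N : ℕ} (α β : Fin N →₀ ℕ) :
    (grevlex N).toSyn α < (grevlex N).toSyn β ↔ GrevlexLT α β := Iff.rfl

/-! ### Normal forms -/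

/-- The monomial ideal generated by the leading terms of the elements of `I`. -/
def ltIdeal {N : ℕ} (I : Ideal (MvPolynomial (Fin N) ℂ)) : Ideal (MvPolynomial (Fin N) ℂ) :=
  Ideal.span ((grevlex N).leadingTerm '' (I : Set (MvPolynomial (Fin N) ℂ)))

/-- The exponents of the basis monomials: those `α` for which `z^α` does not lie in the ideal of
leading terms. -/
def standardExponents {N : ℕ} (I : Ideal (MvPolynomial (Fin N) ℂ)) : Set (Fin N →₀ ℕ) :=
  {α | monomial α (1 : ℂ) ∉ ltIdeal I}

theorem mem_ltIdeal_iff {N : ℕ} (I : Ideal (MvPolynomial (Fin N) ℂ)) (α : Fin N →₀ ℕ) :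
    monomial α (1 : ℂ) ∈ ltIdeal I ↔ ∃ p ∈ I, p ≠ 0 ∧ (grevlex N).degree p ≤ α := by
  classical
  have himg : (fun p : MvPolynomial (Fin N) ℂ => monomial ((grevlex N).degree p) (1 : ℂ)) ''
      ((I : Set (MvPolynomial (Fin N) ℂ)) \ {0}) =
      (fun s => monomial s (1 : ℂ)) '' ((grevlex N).degree ''
        ((I : Set (MvPolynomial (Fin N) ℂ)) \ {0})) := by
    rw [Set.image_image]
  rw [ltIdeal, MonomialOrder.span_leadingTerm_eq_span_monomial', himg,
    mem_ideal_span_monomial_image]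
  simp [support_monomial, and_assoc]

/-- Every polynomial is congruent modulo `I` to exactly one linear combination of basis
monomials. -/
theorem existsUnique_normalForm {N : ℕ} (I : Ideal (MvPolynomial (Fin N) ℂ))
    (p : MvPolynomial (Fin N) ℂ) :
    ∃! r, p - r ∈ I ∧ ∀ α ∈ r.support, α ∈ standardExponents I := by
  obtain ⟨g, r, hp, -, hr⟩ := (grevlex N).div_set
    (B := (I : Set (MvPolynomial (Fin N) ℂ)) \ {0})
    (fun b hb => by simpa using hb.2) p
  refine ⟨r, ⟨?_, ?_⟩, ?_⟩
  · rw [hp, add_sub_cancel_right, Finsupp.linearCombination_apply]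
    refine Ideal.sum_mem _ fun b _ => ?_
    exact I.mul_mem_left _ b.2.1
  · intro α hα hmem
    obtain ⟨q, hq, hq0, hle⟩ := (mem_ltIdeal_iff I α).mp hmem
    exact hr α hα q ⟨hq, hq0⟩ hle
  · rintro s ⟨hs, hs'⟩
    by_contra hne
    have hr' : ∀ α ∈ r.support, α ∈ standardExponents I := by
      intro α hα hmem
      obtain ⟨q, hq, hq0, hle⟩ := (mem_ltIdeal_iff I α).mp hmem
      exact hr α hα q ⟨hq, hq0⟩ hle
    have hpr : p - r ∈ I := by
      rw [hp, add_sub_cancel_right, Finsupp.linearCombination_apply]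
      exact Ideal.sum_mem _ fun b _ => I.mul_mem_left _ b.2.1
    have hd : s - r ∈ I := by
      have := I.sub_mem hpr hs
      rwa [sub_sub_sub_cancel_left] at this
    have hd0 : s - r ≠ 0 := sub_ne_zero.mpr hne
    have hmem : (grevlex N).degree (s - r) ∈ (s - r).support :=
      (grevlex N).degree_mem_support hd0
    have hlt := (mem_ltIdeal_iff I _).mpr ⟨s - r, hd, hd0, le_refl _⟩
    rcases Finset.mem_union.mp (support_sub _ s r hmem) with h | h
    · exact hs' _ h hlt
    · exact hr' _ h hlt

/-- The normal form `ρ(p)` of `p` modulo `I`. -/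
def normalForm {N : ℕ} (I : Ideal (MvPolynomial (Fin N) ℂ)) (p : MvPolynomial (Fin N) ℂ) :
    MvPolynomial (Fin N) ℂ :=
  (existsUnique_normalForm I p).choose

/-- The leading homogeneous part of a polynomial. -/
def leadingForm {N : ℕ} (p : MvPolynomial (Fin N) ℂ) : MvPolynomial (Fin N) ℂ :=
  homogeneousComponent p.totalDegree p

/-- The truncated product of `p` and `q`: the leading homogeneous part of the normal form of `p q`
if no cancellation in degree occurs, and zero otherwise. -/
def hatMul {N : ℕ} (I : Ideal (MvPolynomial (Fin N) ℂ)) (p q : MvPolynomial (Fin N) ℂ) :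
    MvPolynomial (Fin N) ℂ :=
  if (normalForm I (p * q)).totalDegree = p.totalDegree + q.totalDegree then
    leadingForm (normalForm I (p * q))
  else 0

open Classical in
/-- The exponents of the basis monomials of total degree `n`. They index the basis of the space of
homogeneous normal forms of degree `n`. -/
def standardExponentsOfDegree {N : ℕ} (I : Ideal (MvPolynomial (Fin N) ℂ)) (n : ℕ) :
    Finset (Fin N →₀ ℕ) :=
  (Finset.finsuppAntidiag Finset.univ n).filter (· ∈ standardExponents I)

/-- The exponents of the basis monomials of total degree `n`, listed in increasing grevlex
order. -/
def listedExponent {N : ℕ} (I : Ideal (MvPolynomial (Fin N) ℂ)) (n : ℕ) {d : ℕ}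
    (h : (standardExponentsOfDegree I n).card = d) (i : Fin d) : Fin N →₀ ℕ :=
  (grevlex N).toSyn.symm
    (((standardExponentsOfDegree I n).map (grevlex N).toSyn.toEquiv.toEmbedding).orderEmbOfFin
      (by rw [Finset.card_map, h]) i)

/-- The coordinate vector of a homogeneous normal form of degree `n` with respect to the listed
monomial basis. -/
def coordVec {N : ℕ} (I : Ideal (MvPolynomial (Fin N) ℂ)) (n : ℕ) {d : ℕ}
    (h : (standardExponentsOfDegree I n).card = d) (q : MvPolynomial (Fin N) ℂ) : Fin d → ℂ :=
  fun i => coeff (listedExponent I n h i) q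

/-- The multiplication matrix `[[z_j]]` in degree `n`: the matrix, with respect to the listed
monomial bases, of the map `q ↦ hatMul z_j q` from homogeneous normal forms of degree `n` to those
of degree `n + 1`, both spaces having dimension `d`. Its columns are the coordinate vectors of the
images of the basis monomials. -/
def mulMatrix {N : ℕ} (I : Ideal (MvPolynomial (Fin N) ℂ)) (j : Fin N) (n : ℕ) {d : ℕ}
    (h₀ : (standardExponentsOfDegree I n).card = d)
    (h₁ : (standardExponentsOfDegree I (n + 1)).card = d) : Matrix (Fin d) (Fin d) ℂ :=
  Matrix.of fun i k =>
    coordVec I (n + 1) h₁ (hatMul I (X j) (monomial (listedExponent I n h₀ k) 1)) i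

theorem listedExponent_mem {N : ℕ} (I : Ideal (MvPolynomial (Fin N) ℂ)) (n : ℕ) {d : ℕ}
    (h : (standardExponentsOfDegree I n).card = d) (i : Fin d) :
    listedExponent I n h i ∈ standardExponentsOfDegree I n := by
  have := Finset.orderEmbOfFin_mem ((standardExponentsOfDegree I n).map
    (grevlex N).toSyn.toEquiv.toEmbedding) (by rw [Finset.card_map, h]) i
  obtain ⟨α, hα, e⟩ := Finset.mem_map.mp this
  rw [listedExponent, ← e]
  simpa using hα

theorem listedExponent_injective {N : ℕ} (I : Ideal (MvPolynomial (Fin N) ℂ)) (n : ℕ) {d : ℕ}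
    (h : (standardExponentsOfDegree I n).card = d) :
    Function.Injective (listedExponent I n h) := by
  intro i k e
  exact (Finset.orderEmbOfFin _ _).injective ((grevlex N).toSyn.symm.injective e)

theorem normalForm_spec {N : ℕ} (I : Ideal (MvPolynomial (Fin N) ℂ))
    (p : MvPolynomial (Fin N) ℂ) :
    p - normalForm I p ∈ I ∧ ∀ α ∈ (normalForm I p).support, α ∈ standardExponents I :=
  (existsUnique_normalForm I p).choose_spec.1

theorem normalForm_eq {N : ℕ} (I : Ideal (MvPolynomial (Fin N) ℂ))
    (p r : MvPolynomial (Fin N) ℂ) (h : p - r ∈ I)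
    (h' : ∀ α ∈ r.support, α ∈ standardExponents I) : normalForm I p = r :=
  (existsUnique_normalForm I p).unique (normalForm_spec I p) ⟨h, h'⟩

theorem normalForm_sum {N : ℕ} (I : Ideal (MvPolynomial (Fin N) ℂ)) {ι : Type*} (s : Finset ι)
    (c : ι → ℂ) (p : ι → MvPolynomial (Fin N) ℂ) :
    normalForm I (∑ i ∈ s, c i • p i) = ∑ i ∈ s, c i • normalForm I (p i) := by
  classical
  refine normalForm_eq I _ _ ?_ ?_
  · rw [← Finset.sum_sub_distrib]
    refine Ideal.sum_mem _ fun i _ => ?_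
    rw [← smul_sub, smul_eq_C_mul]
    exact I.mul_mem_left _ (normalForm_spec I (p i)).1
  · intro α hα
    obtain ⟨i, -, hi⟩ := Finset.mem_biUnion.mp (support_sum hα)
    exact (normalForm_spec I (p i)).2 α (support_smul hi)

theorem totalDegree_normalForm_le {N : ℕ} (I : Ideal (MvPolynomial (Fin N) ℂ))
    (p : MvPolynomial (Fin N) ℂ) : (normalForm I p).totalDegree ≤ p.totalDegree := by
  obtain ⟨h, h'⟩ := normalForm_spec I p
  set r := normalForm I p
  by_cases hr : r = 0
  · simp [hr]
  have hle : (grevlex N).toSyn ((grevlex N).degree r) ≤ (grevlex N).toSyn ((grevlex N).degree p) := by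
    by_contra hcon
    rw [not_le] at hcon
    have hd : (grevlex N).degree (r - p) = (grevlex N).degree r :=
      (grevlex N).degree_sub_of_lt hcon
    have hne : r - p ≠ 0 := by
      intro h0
      rw [sub_eq_zero.mp h0] at hcon
      exact lt_irrefl _ hcon
    refine h' _ ((grevlex N).degree_mem_support hr)
      ((mem_ltIdeal_iff I _).mpr ⟨r - p, ?_, hne, hd.le⟩)
    rw [← neg_sub]
    exact I.neg_mem h
  have hdeg : ∀ α β : Fin N →₀ ℕ, (grevlex N).toSyn α ≤ (grevlex N).toSyn β →
      α.degree ≤ β.degree := by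
    intro α β hab
    rcases eq_or_lt_of_le hab with e | e
    · rw [(grevlex N).toSyn.injective e]
    · rcases (grevlex_lt_iff α β).mp e with e | ⟨e, -⟩
      · exact e.le
      · exact e.le
  have hp : p ≠ 0 := by
    intro h0
    have : (grevlex N).degree r ∈ r.support := (grevlex N).degree_mem_support hr
    refine h' _ this ((mem_ltIdeal_iff I _).mpr ⟨r, ?_, hr, le_refl _⟩)
    rw [h0, zero_sub] at h
    exact I.neg_mem_iff.mp h
  rw [totalDegree_eq, Finset.sup_le_iff]
  intro α hα
  rw [Finsupp.card_toMultiset]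
  refine (hdeg _ _ (((grevlex N).le_degree hα).trans hle)).trans ?_
  exact le_totalDegree ((grevlex N).degree_mem_support hp)

/-- The truncated product of a variable with a homogeneous polynomial of degree `n` is the
component of degree `n + 1` of the normal form of the product; in particular it is linear. -/
theorem hatMul_X_eq {N : ℕ} (I : Ideal (MvPolynomial (Fin N) ℂ)) (j : Fin N) (n : ℕ)
    (q : MvPolynomial (Fin N) ℂ) (hq : q.IsHomogeneous n) :
    hatMul I (X j) q = homogeneousComponent (n + 1) (normalForm I (X j * q)) := by
  by_cases h0 : q = 0
  · subst h0
    have : normalForm I 0 = 0 := normalForm_eq I 0 0 (by simp) (by simp)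
    simp [hatMul, this]
  have hle := totalDegree_normalForm_le I (X j * q)
  have hX : (X j * q).totalDegree = n + 1 :=
    (by simpa [add_comm] using (isHomogeneous_X ℂ j).mul hq :
      (X j * q).IsHomogeneous (n + 1)).totalDegree (mul_ne_zero (X_ne_zero j) h0)
  rw [hX] at hle
  rw [hatMul, hq.totalDegree h0, totalDegree_X, add_comm 1 n]
  split_ifs with h
  · rw [leadingForm, h]
  · exact (homogeneousComponent_eq_zero _ _ (lt_of_le_of_ne hle h)).symm

/-- The defining equation of the multiplication matrix: `[[z_j]] [q] = [hatMul z_j q]` for every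
homogeneous normal form `q` of degree `n`. -/
theorem mulMatrix_mulVec_coordVec {N : ℕ} (I : Ideal (MvPolynomial (Fin N) ℂ)) (j : Fin N)
    (n : ℕ) {d : ℕ} (h₀ : (standardExponentsOfDegree I n).card = d)
    (h₁ : (standardExponentsOfDegree I (n + 1)).card = d) (q : MvPolynomial (Fin N) ℂ)
    (hq : q.IsHomogeneous n) (hq' : ∀ α ∈ q.support, α ∈ standardExponents I) :
    (mulMatrix I j n h₀ h₁).mulVec (coordVec I n h₀ q) =
      coordVec I (n + 1) h₁ (hatMul I (X j) q) := by
  classical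
  have hmem : ∀ α, α ∈ standardExponentsOfDegree I n ↔ α.degree = n ∧ α ∈ standardExponents I := by
    intro α
    simp [standardExponentsOfDegree, Finset.mem_finsuppAntidiag, Finsupp.degree_eq_sum]
  have himg : Finset.univ.image (listedExponent I n h₀) = standardExponentsOfDegree I n := by
    refine Finset.eq_of_subset_of_card_le ?_ ?_
    · intro α hα
      obtain ⟨i, -, rfl⟩ := Finset.mem_image.mp hα
      exact listedExponent_mem I n h₀ i
    · rw [Finset.card_image_of_injective _ (listedExponent_injective I n h₀), h₀]
      simp
  have hsum : q = ∑ k, coeff (listedExponent I n h₀ k) q •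
      monomial (listedExponent I n h₀ k) (1 : ℂ) := by
    rw [← Finset.sum_image (f := fun α => coeff α q • monomial α (1 : ℂ))
      (fun _ _ _ _ e => listedExponent_injective I n h₀ e), himg]
    conv_lhs => rw [q.as_sum]
    simp only [smul_monomial, smul_eq_mul, mul_one]
    refine Finset.sum_subset ?_ ?_
    · intro α hα
      refine (hmem α).mpr ⟨?_, hq' α hα⟩
      have := hq (mem_support_iff.mp hα)
      rwa [Finsupp.degree_eq_weight_one]
    · intro α _ hα
      rw [notMem_support_iff.mp hα, monomial_zero]
  have hmon : ∀ k, (monomial (listedExponent I n h₀ k) (1 : ℂ)).IsHomogeneous n := fun k =>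
    isHomogeneous_monomial _ ((hmem _).mp (listedExponent_mem I n h₀ k)).1
  have hprod : X j * q = ∑ k, coeff (listedExponent I n h₀ k) q •
      (X j * monomial (listedExponent I n h₀ k) (1 : ℂ)) := by
    conv_lhs => rw [hsum]
    rw [Finset.mul_sum]
    exact Finset.sum_congr rfl fun k _ => mul_smul_comm _ _ _
  funext i
  rw [hatMul_X_eq I j n q hq, hprod, normalForm_sum, map_sum, coordVec, coeff_sum]
  simp only [Matrix.mulVec, dotProduct, mulMatrix, Matrix.of_apply]
  refine Finset.sum_congr rfl fun k _ => ?_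
  rw [coordVec, coordVec, hatMul_X_eq I j n _ (hmon k), map_smul, coeff_smul, smul_eq_mul, mul_comm]

/-! ### Algebraic curves and their points at infinity -/

/-- The ideal of all polynomials that vanish on `V`. -/
abbrev idealOf {N : ℕ} (V : Set (Fin N → ℂ)) : Ideal (MvPolynomial (Fin N) ℂ) :=
  vanishingIdeal ℂ V

/-- The elements of the coordinate ring of `V` of degree at most `s`, i.e. the classes of
polynomials of total degree at most `s`. -/
def coordRingLE {N : ℕ} (V : Set (Fin N → ℂ)) (s : ℕ) :
    Submodule ℂ (MvPolynomial (Fin N) ℂ ⧸ idealOf V) :=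
  (restrictTotalDegree (Fin N) ℂ s).map (Ideal.Quotient.mkₐ ℂ (idealOf V)).toLinearMap

/-- `V ⊆ ℂ^N` is an algebraic curve: it is the common zero set of finitely many polynomials, and
its Hilbert polynomial has degree one. -/
structure IsAlgebraicCurve {N : ℕ} (V : Set (Fin N → ℂ)) : Prop where
  exists_equations : ∃ P : Finset (MvPolynomial (Fin N) ℂ), V = {z | ∀ p ∈ P, eval z p = 0}
  hilbert : ∃ a b : ℤ, 0 < a ∧
    ∀ᶠ s : ℕ in Filter.atTop, (Module.finrank ℂ (coordRingLE V s) : ℤ) = a * s + b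

/-- Complex projective `N`-space, with homogeneous coordinates `[z_0 : z_1 : ⋯ : z_N]`. -/
abbrev ProjSpace (N : ℕ) : Type := Projectivization ℂ (Fin (N + 1) → ℂ)

/-- The embedding `(z_1, …, z_N) ↦ [1 : z_1 : ⋯ : z_N]` of affine space. -/
def affinePoint {N : ℕ} (z : Fin N → ℂ) : ProjSpace N :=
  Projectivization.mk ℂ (Fin.cons 1 z) fun h => one_ne_zero (congrFun h 0)

/-- The point `[0 : w_1 : ⋯ : w_N]` of the hyperplane at infinity. -/
def pointAtInfinity {N : ℕ} (w : Fin N → ℂ) (hw : w ≠ 0) : ProjSpace N :=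
  Projectivization.mk ℂ (Fin.cons 0 w) fun h => hw (funext fun i => congrFun h i.succ)

/-- A projective variety: the common zero set of finitely many homogeneous polynomials. -/
def IsProjectiveVariety {N : ℕ} (S : Set (ProjSpace N)) : Prop :=
  ∃ Q : Finset (MvPolynomial (Fin (N + 1)) ℂ),
    (∀ q ∈ Q, ∃ k, q.IsHomogeneous k) ∧ S = {x | ∀ q ∈ Q, eval x.rep q = 0}

/-- The projective closure of `V`, the smallest projective variety that contains `V`. -/
def projClosure {N : ℕ} (V : Set (Fin N → ℂ)) : Set (ProjSpace N) :=
  ⋂₀ {S | IsProjectiveVariety S ∧ affinePoint '' V ⊆ S}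

end CurveComputation

end

noncomputable section

namespace CurveComputation

/-! ### Initial forms -/

/-! Let in(I) be the ideal of top-degree forms of elements of I. Its common zeros are the points at
infinity of V (`pointAtInfinity_mem_projClosure_iff`). Since grevlex compares total degrees first,
the standard monomials of degree n form a basis of the degree-n piece of ℂ[z]/in(I), so `[[z_j]]` is
multiplication by z_j on this graded ring. The Hilbert polynomial as + b makes these pieces have
dimension d = a in high degree.

Part 1. Evaluation at a point w at infinity descends to ℂ[z]/in(I) and carries multiplication by z_j
to multiplication by w_j. This is a left eigenvector equation as soon as the bases in degrees n and
n+1 have the same values at w, and for w_1 = 1 this holds where the two bases differ by a factor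
z_1. In general they correspond in this way only on monomials divisible by a fixed power z_1^K
(`exists_eventually_stableAbove`, `listedExponent_succ`). In grevlex z_1 is the smallest variable,
so reduction preserves divisibility by z_1^K (`le_of_mem_support_normalPart`). Hence `[[z_j]]` is
block triangular, and evaluation at w gives a left eigenvector of the block indexed by these
monomials (`hasEigenvalue_of_point`).

Parts 2 and 3. If a linear form l vanishes at no point at infinity, the Nullstellensatz makes
multiplication by l surjective in high degree (`eventually_exists_sub_mul_mem`), and equality of
dimensions makes it injective (`eq_zero_of_mul_mem_initialForms`). Taking l = z_j gives part 3. For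
part 2, taking l = z_1 shows that K = 0 works, so an eigenvector q for λ satisfies (z_j - λ z_1) q ∈
in(I). If no point at infinity had z_j = λ z_1, injectivity would force q = 0. -/

theorem homogeneousComponent_mul_of_isHomogeneous {N m : ℕ} {g : MvPolynomial (Fin N) ℂ}
    (hg : g.IsHomogeneous m) (n : ℕ) (p : MvPolynomial (Fin N) ℂ) :
    homogeneousComponent n (g * p) = if m ≤ n then g * homogeneousComponent (n - m) p else 0 := by
  have key : ∀ i, homogeneousComponent n (g * homogeneousComponent i p) =
      if n = m + i then g * homogeneousComponent i p else 0 := fun i =>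
    homogeneousComponent_of_mem
      ((mem_homogeneousSubmodule _ _).mpr (hg.mul (homogeneousComponent_isHomogeneous i p)))
  conv_lhs => rw [← sum_homogeneousComponent p, Finset.mul_sum, map_sum]
  simp_rw [key]
  split_ifs with h
  · rw [Finset.sum_eq_single (n - m)]
    · rw [if_pos (by omega)]
    · intro i _ hi
      rw [if_neg (by omega)]
    · intro hi
      rw [Finset.mem_range, not_lt] at hi
      rw [homogeneousComponent_eq_zero _ _ (by omega), mul_zero, ite_self]
  · refine Finset.sum_eq_zero fun i _ => ?_
    rw [if_neg (by omega)]

/-- The components of degree `n` of the elements of `I` of degree at most `n`. -/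
def initialForms {N : ℕ} (I : Ideal (MvPolynomial (Fin N) ℂ)) (n : ℕ) :
    Submodule ℂ (MvPolynomial (Fin N) ℂ) :=
  (I.restrictScalars ℂ ⊓ restrictTotalDegree (Fin N) ℂ n).map (homogeneousComponent n)

theorem mem_initialForms {N : ℕ} {I : Ideal (MvPolynomial (Fin N) ℂ)} {n : ℕ}
    {f : MvPolynomial (Fin N) ℂ} :
    f ∈ initialForms I n ↔ ∃ p ∈ I, p.totalDegree ≤ n ∧ homogeneousComponent n p = f := by
  simp [initialForms, mem_restrictTotalDegree, and_assoc]

theorem isHomogeneous_of_mem_initialForms {N : ℕ} {I : Ideal (MvPolynomial (Fin N) ℂ)} {n : ℕ}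
    {f : MvPolynomial (Fin N) ℂ} (hf : f ∈ initialForms I n) : f.IsHomogeneous n := by
  obtain ⟨p, -, -, rfl⟩ := mem_initialForms.mp hf
  exact homogeneousComponent_isHomogeneous n p

theorem mul_mem_initialForms {N : ℕ} {I : Ideal (MvPolynomial (Fin N) ℂ)} {m n : ℕ}
    {f g : MvPolynomial (Fin N) ℂ} (hg : g.IsHomogeneous m) (hf : f ∈ initialForms I n) :
    g * f ∈ initialForms I (m + n) := by
  obtain ⟨p, hp, hd, rfl⟩ := mem_initialForms.mp hf
  refine mem_initialForms.mpr ⟨g * p, I.mul_mem_left _ hp, ?_, ?_⟩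
  · exact (totalDegree_mul _ _).trans (add_le_add hg.totalDegree_le hd)
  · rw [homogeneousComponent_mul_of_isHomogeneous hg, if_pos (by omega), Nat.add_sub_cancel_left]

/-- The homogeneous ideal generated by the leading homogeneous parts of the elements of `I`. -/
def initialIdeal {N : ℕ} (I : Ideal (MvPolynomial (Fin N) ℂ)) :
    Ideal (MvPolynomial (Fin N) ℂ) where
  carrier := {f | ∀ n, homogeneousComponent n f ∈ initialForms I n}
  add_mem' hf hg n := by
    rw [map_add]
    exact add_mem (hf n) (hg n)
  zero_mem' n := by simp
  smul_mem' c f hf n := by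
    rw [smul_eq_mul, ← sum_homogeneousComponent c, Finset.sum_mul, map_sum]
    refine sum_mem fun i _ => ?_
    rw [homogeneousComponent_mul_of_isHomogeneous (homogeneousComponent_isHomogeneous i c)]
    split_ifs with h
    · have := mul_mem_initialForms (homogeneousComponent_isHomogeneous i c) (hf (n - i))
      rwa [Nat.add_sub_cancel' h] at this
    · exact zero_mem _

theorem initialForms_le_initialIdeal {N : ℕ} {I : Ideal (MvPolynomial (Fin N) ℂ)} {n : ℕ}
    {f : MvPolynomial (Fin N) ℂ} (hf : f ∈ initialForms I n) : f ∈ initialIdeal I := by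
  intro m
  rw [homogeneousComponent_of_mem
    ((mem_homogeneousSubmodule _ _).mpr (isHomogeneous_of_mem_initialForms hf))]
  split_ifs with h
  · rwa [h]
  · exact zero_mem _

/-! ### Standard monomials and initial forms -/

theorem standardExponents_of_le {N : ℕ} {I : Ideal (MvPolynomial (Fin N) ℂ)}
    {α β : Fin N →₀ ℕ} (hα : α ∈ standardExponents I) (h : β ≤ α) : β ∈ standardExponents I := by
  intro hβ
  obtain ⟨p, hp, hp0, hle⟩ := (mem_ltIdeal_iff I β).mp hβ
  exact hα ((mem_ltIdeal_iff I α).mpr ⟨p, hp, hp0, hle.trans h⟩)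

theorem mem_standardExponentsOfDegree {N : ℕ} {I : Ideal (MvPolynomial (Fin N) ℂ)} {n : ℕ}
    {α : Fin N →₀ ℕ} :
    α ∈ standardExponentsOfDegree I n ↔ α.degree = n ∧ α ∈ standardExponents I := by
  simp [standardExponentsOfDegree, Finset.mem_finsuppAntidiag, Finsupp.degree_eq_sum]

theorem degree_eq_of_mem_support {N n : ℕ} {f : MvPolynomial (Fin N) ℂ} (hf : f.IsHomogeneous n)
    {α : Fin N →₀ ℕ} (hα : α ∈ f.support) : α.degree = n := by
  have := hf (mem_support_iff.mp hα)
  rwa [Finsupp.degree_eq_weight_one]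

/-- A polynomial of degree at most n and its component of degree n, when that component is nonzero,
have the same leading monomial, because the order refines total degree. -/
theorem degree_notMem_standardExponents {N : ℕ} {I : Ideal (MvPolynomial (Fin N) ℂ)} {n : ℕ}
    {f : MvPolynomial (Fin N) ℂ} (hf : f ∈ initialForms I n) (h0 : f ≠ 0) :
    (grevlex N).degree f ∉ standardExponents I := by
  have hhom := isHomogeneous_of_mem_initialForms hf
  have hmem := (grevlex N).degree_mem_support h0
  have hdeg := degree_eq_of_mem_support hhom hmem
  obtain ⟨p, hp, hd, rfl⟩ := mem_initialForms.mp hf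
  set f := homogeneousComponent n p with hfdef
  have hp0 : p ≠ 0 := by
    rintro rfl
    simp [hfdef] at h0
  rw [standardExponents, Set.mem_ofPred_eq, not_not, mem_ltIdeal_iff]
  refine ⟨p, hp, hp0, le_of_eq ((grevlex N).toSyn.injective (le_antisymm ?_ ?_))⟩
  · have hβ := (grevlex N).degree_mem_support hp0
    have hle : ((grevlex N).degree p).degree ≤ n := (le_totalDegree hβ).trans hd
    rcases hle.lt_or_eq with h | h
    · exact le_of_lt ((grevlex_lt_iff _ _).mpr (Or.inl (by rwa [hdeg])))
    · refine (grevlex N).le_degree ?_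
      rw [mem_support_iff, hfdef, coeff_homogeneousComponent, if_pos h]
      exact mem_support_iff.mp hβ
  · refine (grevlex N).le_degree ?_
    rw [mem_support_iff, hfdef, coeff_homogeneousComponent, if_pos hdeg] at hmem
    exact mem_support_iff.mpr hmem

/-- Independence of the standard monomials modulo initial forms; the spanning half is
`sub_normalPart_mem`. -/
theorem eq_zero_of_mem_initialForms {N : ℕ} {I : Ideal (MvPolynomial (Fin N) ℂ)} {n : ℕ}
    {r : MvPolynomial (Fin N) ℂ} (hr : r ∈ initialForms I n)
    (hs : ∀ α ∈ r.support, α ∈ standardExponents I) : r = 0 := by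
  by_contra h0
  exact degree_notMem_standardExponents hr h0 (hs _ ((grevlex N).degree_mem_support h0))

theorem normalForm_add {N : ℕ} (I : Ideal (MvPolynomial (Fin N) ℂ))
    (p q : MvPolynomial (Fin N) ℂ) : normalForm I (p + q) = normalForm I p + normalForm I q := by
  simpa [Fin.sum_univ_two] using normalForm_sum I Finset.univ (fun _ : Fin 2 => 1) ![p, q]

theorem normalForm_smul {N : ℕ} (I : Ideal (MvPolynomial (Fin N) ℂ)) (c : ℂ)
    (p : MvPolynomial (Fin N) ℂ) : normalForm I (c • p) = c • normalForm I p := by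
  simpa using normalForm_sum I Finset.univ (fun _ : Fin 1 => c) ![p]

/-- The component of degree `n` of the normal form. -/
def normalPart {N : ℕ} (I : Ideal (MvPolynomial (Fin N) ℂ)) (n : ℕ) :
    MvPolynomial (Fin N) ℂ →ₗ[ℂ] MvPolynomial (Fin N) ℂ where
  toFun f := homogeneousComponent n (normalForm I f)
  map_add' f g := by rw [normalForm_add, map_add]
  map_smul' c f := by rw [normalForm_smul, map_smul, RingHom.id_apply]

theorem normalPart_apply {N : ℕ} (I : Ideal (MvPolynomial (Fin N) ℂ)) (n : ℕ)
    (f : MvPolynomial (Fin N) ℂ) :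
    normalPart I n f = homogeneousComponent n (normalForm I f) := rfl

theorem sub_normalPart_mem {N : ℕ} (I : Ideal (MvPolynomial (Fin N) ℂ)) {n : ℕ}
    {f : MvPolynomial (Fin N) ℂ} (hf : f.IsHomogeneous n) :
    f - normalPart I n f ∈ initialForms I n := by
  refine mem_initialForms.mpr ⟨f - normalForm I f, (normalForm_spec I f).1, ?_, ?_⟩
  · refine (totalDegree_sub _ _).trans (max_le hf.totalDegree_le ?_)
    exact (totalDegree_normalForm_le I f).trans hf.totalDegree_le
  · rw [map_sub, homogeneousComponent_eq_self hf, normalPart_apply]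

theorem isHomogeneous_normalPart {N : ℕ} (I : Ideal (MvPolynomial (Fin N) ℂ)) (n : ℕ)
    (f : MvPolynomial (Fin N) ℂ) : (normalPart I n f).IsHomogeneous n :=
  homogeneousComponent_isHomogeneous _ _

theorem mem_standardExponents_of_mem_support_normalPart {N : ℕ}
    {I : Ideal (MvPolynomial (Fin N) ℂ)} {n : ℕ} {f : MvPolynomial (Fin N) ℂ} {α : Fin N →₀ ℕ}
    (hα : α ∈ (normalPart I n f).support) : α ∈ standardExponents I := by
  rw [normalPart_apply, mem_support_iff, coeff_homogeneousComponent] at hα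
  refine (normalForm_spec I f).2 α (mem_support_iff.mpr fun h => hα ?_)
  rw [h, ite_self]

theorem normalPart_eq {N : ℕ} {I : Ideal (MvPolynomial (Fin N) ℂ)} {n : ℕ}
    {f r : MvPolynomial (Fin N) ℂ} (hf : f.IsHomogeneous n) (h : f - r ∈ initialForms I n)
    (hs : ∀ α ∈ r.support, α ∈ standardExponents I) : normalPart I n f = r := by
  classical
  have h1 : normalPart I n f - r ∈ initialForms I n := by
    have := sub_mem h (sub_normalPart_mem I hf)
    rwa [sub_sub_sub_cancel_left] at this
  refine sub_eq_zero.mp (eq_zero_of_mem_initialForms h1 fun α hα => ?_)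
  rcases Finset.mem_union.mp (support_sub _ _ _ hα) with h | h
  · exact mem_standardExponents_of_mem_support_normalPart h
  · exact hs α h

theorem normalPart_eq_zero_iff {N : ℕ} {I : Ideal (MvPolynomial (Fin N) ℂ)} {n : ℕ}
    {f : MvPolynomial (Fin N) ℂ} (hf : f.IsHomogeneous n) :
    normalPart I n f = 0 ↔ f ∈ initialForms I n := by
  constructor
  · intro h
    simpa [h] using sub_normalPart_mem I hf
  · intro h
    exact normalPart_eq hf (by simpa using h) (by simp)

/-- The grevlex property: the normal form of a homogeneous polynomial divisible by `z_1^k` is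
divisible by `z_1^k`. -/
theorem le_of_mem_support_normalPart {N : ℕ} [NeZero N] {I : Ideal (MvPolynomial (Fin N) ℂ)}
    {n k : ℕ} {f : MvPolynomial (Fin N) ℂ} (hf : f.IsHomogeneous n)
    (hk : ∀ α ∈ f.support, k ≤ α 0) {α : Fin N →₀ ℕ} (hα : α ∈ (normalPart I n f).support) :
    k ≤ α 0 := by
  by_contra hlt
  rw [not_le] at hlt
  set r := normalPart I n f
  have hmem : f - r ∈ initialForms I n := sub_normalPart_mem I hf
  have hhom := isHomogeneous_of_mem_initialForms hmem
  -- In the range of exponents where z_1 occurs to a power below k, f contributes nothing, so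
  -- monomials of f - r there come from r and are standard.
  have low : ∀ β : Fin N →₀ ℕ, β 0 < k → coeff β (f - r) = -coeff β r := by
    intro β hβ
    have : coeff β f = 0 := notMem_support_iff.mp fun h => absurd (hk β h) (not_le.mpr hβ)
    rw [coeff_sub, this, zero_sub]
  have hα' : α ∈ (f - r).support := by
    rw [mem_support_iff, low α hlt, neg_ne_zero]
    exact mem_support_iff.mp hα
  have h0 : f - r ≠ 0 := by
    intro h
    simp [h] at hα'
  have hμ := (grevlex N).degree_mem_support h0
  have hnot := degree_notMem_standardExponents hmem h0
  have hle := (grevlex N).le_degree hα'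
  set μ := (grevlex N).degree (f - r)
  -- All monomials of f - r have the same degree, and at equal degree a grevlex-larger monomial has
  -- no larger power of z_1. So the leading monomial also lies in the low range: it would be
  -- standard and leading at once.
  have hμ0 : μ 0 < k := by
    rcases hle.eq_or_lt with h | h
    · rwa [← (grevlex N).toSyn.injective h]
    · rcases (grevlex_lt_iff _ _).mp h with h | ⟨-, i, hi, hi'⟩
      · rw [degree_eq_of_mem_support hhom hα', degree_eq_of_mem_support hhom hμ] at h
        exact absurd h (lt_irrefl _)
      · rcases (Fin.zero_le i).eq_or_lt with h | h
        · exact lt_trans (h ▸ hi) hlt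
        · exact (hi' 0 h) ▸ hlt
  refine hnot (mem_standardExponents_of_mem_support_normalPart (f := f) (n := n) ?_)
  rw [mem_support_iff, low μ hμ0, neg_ne_zero] at hμ
  exact mem_support_iff.mpr hμ

/-! ### The Hilbert function -/

theorem finrank_restrictSupport {N : ℕ} (s : Finset (Fin N →₀ ℕ)) :
    Module.finrank ℂ (restrictSupport ℂ (s : Set (Fin N →₀ ℕ))) = s.card := by
  rw [Module.finrank_eq_card_basis (basisRestrictSupport ℂ (s : Set (Fin N →₀ ℕ)))]
  simp

theorem finite_restrictSupport {N : ℕ} (s : Finset (Fin N →₀ ℕ)) :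
    Module.Finite ℂ (restrictSupport ℂ (s : Set (Fin N →₀ ℕ))) :=
  Module.Finite.of_basis (basisRestrictSupport ℂ (s : Set (Fin N →₀ ℕ)))

-- Normal forms do not raise the degree, so standard monomials of degree at most s span; uniqueness
-- of normal forms makes their classes independent.
open Classical in
theorem finrank_coordRingLE {N : ℕ} (V : Set (Fin N → ℂ)) (s : ℕ) :
    Module.finrank ℂ (coordRingLE V s) =
      ((Finset.range (s + 1)).biUnion (standardExponentsOfDegree (idealOf V))).card := by
  set T := (Finset.range (s + 1)).biUnion (standardExponentsOfDegree (idealOf V)) with hT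
  have hmem : ∀ α, α ∈ T ↔ α.degree ≤ s ∧ α ∈ standardExponents (idealOf V) := by
    intro α
    simp [hT, mem_standardExponentsOfDegree]
  have hmap : coordRingLE V s = (restrictSupport ℂ (T : Set (Fin N →₀ ℕ))).map
      (Ideal.Quotient.mkₐ ℂ (idealOf V)).toLinearMap := by
    apply le_antisymm
    · rintro _ ⟨p, hp, rfl⟩
      refine ⟨normalForm (idealOf V) p, ?_, ?_⟩
      · intro α hα
        refine (hmem α).mpr ⟨?_, (normalForm_spec _ p).2 α hα⟩
        exact (le_totalDegree hα).trans ((totalDegree_normalForm_le _ p).trans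
          ((mem_restrictTotalDegree _ _ _).mp hp))
      · exact ((Ideal.Quotient.mk_eq_mk_iff_sub_mem _ _).mpr (normalForm_spec _ p).1).symm
    · rintro _ ⟨p, hp, rfl⟩
      refine ⟨p, (mem_restrictTotalDegree _ _ _).mpr ?_, rfl⟩
      rw [totalDegree_eq, Finset.sup_le_iff]
      intro α hα
      rw [Finsupp.card_toMultiset]
      exact ((hmem α).mp (hp hα)).1
  rw [hmap, ← finrank_restrictSupport T]
  refine LinearEquiv.finrank_eq (LinearEquiv.ofBijective
    ((Ideal.Quotient.mkₐ ℂ (idealOf V)).toLinearMap.submoduleMap _)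
      ⟨?_, LinearMap.submoduleMap_surjective _ _⟩).symm
  rw [← LinearMap.ker_eq_bot, LinearMap.ker_eq_bot']
  rintro ⟨p, hp⟩ h
  have hpI : p ∈ idealOf V := Ideal.Quotient.eq_zero_iff_mem.mp (congrArg Subtype.val h)
  have hp0 : normalForm (idealOf V) p = p :=
    normalForm_eq _ _ _ (by simp) fun α hα => ((hmem α).mp (hp hα)).2
  have hp1 : normalForm (idealOf V) p = 0 := normalForm_eq _ _ _ (by simpa using hpI) (by simp)
  exact Subtype.ext (hp0.symm.trans hp1)

/-- The count in degree n is the difference of consecutive values of as + b, so d = a. -/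
theorem exists_card_standardExponentsOfDegree {N : ℕ} {V : Set (Fin N → ℂ)}
    (hV : IsAlgebraicCurve V) :
    ∃ d : ℕ, 0 < d ∧ ∀ᶠ n : ℕ in Filter.atTop,
      (standardExponentsOfDegree (idealOf V) n).card = d := by
  classical
  obtain ⟨a, b, ha, h⟩ := hV.hilbert
  refine ⟨a.toNat, by omega, ?_⟩
  obtain ⟨s, hs⟩ := Filter.eventually_atTop.mp h
  filter_upwards [Filter.eventually_ge_atTop (s + 1)] with n hn
  obtain ⟨m, rfl⟩ := Nat.exists_eq_add_of_le' (le_of_add_le_right hn)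
  have h1 := hs m (by omega)
  have h2 := hs (m + 1) (by omega)
  rw [finrank_coordRingLE] at h1 h2
  rw [Finset.range_add_one, Finset.biUnion_insert, Finset.card_union_of_disjoint] at h2
  · push_cast at h2 ⊢
    rw [h1] at h2
    have h3 : a * ((m : ℤ) + 1) = a * m + a := by ring
    omega
  · rw [Finset.disjoint_left]
    intro α hα hα'
    obtain ⟨i, hi, hi'⟩ := Finset.mem_biUnion.mp hα'
    rw [Finset.mem_range] at hi
    have e1 := (mem_standardExponentsOfDegree.mp hα).1
    have e2 := (mem_standardExponentsOfDegree.mp hi').1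
    omega

/-! ### Points at infinity -/

theorem eval_smul_of_isHomogeneous {σ : Type*} {q : MvPolynomial σ ℂ} {k : ℕ}
    (hq : q.IsHomogeneous k) (c : ℂ) (v : σ → ℂ) : eval (c • v) q = c ^ k * eval v q := by
  rw [eval_eq, eval_eq, Finset.mul_sum]
  refine Finset.sum_congr rfl fun α hα => ?_
  have hd : α.degree = k := by
    have := hq (mem_support_iff.mp hα)
    rwa [Finsupp.degree_eq_weight_one]
  simp only [Pi.smul_apply, smul_eq_mul, mul_pow, Finset.prod_mul_distrib]
  rw [Finset.prod_pow_eq_pow_sum, ← Finsupp.degree_apply, hd]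
  ring

theorem eval_rep_mk_eq_zero_iff {N k : ℕ} {q : MvPolynomial (Fin (N + 1)) ℂ}
    (hq : q.IsHomogeneous k) (v : Fin (N + 1) → ℂ) (hv : v ≠ 0) :
    eval (Projectivization.mk ℂ v hv).rep q = 0 ↔ eval v q = 0 := by
  obtain ⟨a, ha⟩ := Projectivization.exists_smul_eq_mk_rep ℂ v hv
  rw [← ha, Units.smul_def, eval_smul_of_isHomogeneous hq]
  simp

/-- The homogenization of `p` in degree `m`. -/
def homogenize {N : ℕ} (m : ℕ) (p : MvPolynomial (Fin N) ℂ) : MvPolynomial (Fin (N + 1)) ℂ :=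
  ∑ i ∈ Finset.range (m + 1), X 0 ^ (m - i) * rename Fin.succ (homogeneousComponent i p)

theorem isHomogeneous_homogenize {N : ℕ} (m : ℕ) (p : MvPolynomial (Fin N) ℂ) :
    (homogenize m p).IsHomogeneous m := by
  refine IsHomogeneous.sum _ _ _ fun i hi => ?_
  have := (isHomogeneous_X_pow (R := ℂ) (0 : Fin (N + 1)) (m - i)).mul
    ((homogeneousComponent_isHomogeneous i p).rename_isHomogeneous (f := Fin.succ))
  rwa [Nat.sub_add_cancel (Nat.lt_succ_iff.mp (Finset.mem_range.mp hi))] at this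

theorem eval_one_homogenize {N m : ℕ} {p : MvPolynomial (Fin N) ℂ} (hp : p.totalDegree ≤ m)
    (z : Fin N → ℂ) : eval (Fin.cons 1 z : Fin (N + 1) → ℂ) (homogenize m p) = eval z p := by
  have h : ∑ i ∈ Finset.range (m + 1), homogeneousComponent i p = p := by
    conv_rhs => rw [← sum_homogeneousComponent p]
    refine (Finset.sum_subset (fun i hi => ?_) fun i _ hi => ?_).symm
    · rw [Finset.mem_range] at hi ⊢
      omega
    · exact homogeneousComponent_eq_zero _ _ (by rw [Finset.mem_range] at hi; omega)
  conv_rhs => rw [← h]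
  rw [homogenize, map_sum, map_sum]
  refine Finset.sum_congr rfl fun i _ => ?_
  rw [map_mul, map_pow, eval_X, Fin.cons_zero, one_pow, one_mul, eval_rename]
  rfl

theorem eval_zero_homogenize {N : ℕ} (m : ℕ) (p : MvPolynomial (Fin N) ℂ) (w : Fin N → ℂ) :
    eval (Fin.cons 0 w : Fin (N + 1) → ℂ) (homogenize m p) =
      eval w (homogeneousComponent m p) := by
  rw [homogenize, map_sum, Finset.sum_range_succ, Finset.sum_eq_zero, zero_add, Nat.sub_self,
    pow_zero, one_mul, eval_rename]
  · rfl
  · intro i hi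
    rw [Finset.mem_range] at hi
    rw [map_mul, map_pow, eval_X, Fin.cons_zero, zero_pow (by omega), zero_mul]

/-- Setting the homogenizing coordinate to one. -/
def dehomogenize {N : ℕ} : MvPolynomial (Fin (N + 1)) ℂ →ₐ[ℂ] MvPolynomial (Fin N) ℂ :=
  aeval (Fin.cons 1 X)

theorem eval_dehomogenize {N : ℕ} (q : MvPolynomial (Fin (N + 1)) ℂ) (z : Fin N → ℂ) :
    eval z (dehomogenize q) = eval (Fin.cons 1 z : Fin (N + 1) → ℂ) q := by
  have : (eval z).comp (dehomogenize (N := N)).toRingHom =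
      eval (Fin.cons 1 z : Fin (N + 1) → ℂ) := by
    refine ringHom_ext (fun r => by simp [dehomogenize]) fun i => ?_
    refine Fin.cases ?_ (fun i => ?_) i <;> simp [dehomogenize]
  exact congrArg (fun f => f q) this

theorem dehomogenize_monomial {N : ℕ} (α : Fin (N + 1) →₀ ℕ) (c : ℂ) :
    dehomogenize (monomial α c) = monomial α.tail c := by
  rw [dehomogenize, aeval_monomial, monomial_eq, Finsupp.prod_fintype _ _ (by simp),
    Finsupp.prod_fintype _ _ (by simp), Fin.prod_univ_succ]
  simp [Finsupp.tail_apply]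

theorem degree_eq_add_degree_tail {N : ℕ} (α : Fin (N + 1) →₀ ℕ) :
    α.degree = α 0 + α.tail.degree := by
  simp [Finsupp.degree_eq_sum, Fin.sum_univ_succ, Finsupp.tail_apply]

theorem totalDegree_dehomogenize_le {N k : ℕ} {q : MvPolynomial (Fin (N + 1)) ℂ}
    (hq : q.IsHomogeneous k) : (dehomogenize q).totalDegree ≤ k := by
  rw [q.as_sum, map_sum]
  refine totalDegree_finsetSum_le fun α hα => ?_
  rw [dehomogenize_monomial]
  refine (totalDegree_monomial_le _ _).trans ?_
  have := degree_eq_add_degree_tail α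
  rw [degree_eq_of_mem_support hq hα] at this
  change α.tail.degree ≤ k
  omega

theorem eval_homogeneousComponent_dehomogenize {N k : ℕ} {q : MvPolynomial (Fin (N + 1)) ℂ}
    (hq : q.IsHomogeneous k) (w : Fin N → ℂ) :
    eval w (homogeneousComponent k (dehomogenize q)) =
      eval (Fin.cons 0 w : Fin (N + 1) → ℂ) q := by
  rw [q.as_sum, map_sum, map_sum, map_sum, map_sum]
  refine Finset.sum_congr rfl fun α hα => ?_
  have hd := degree_eq_add_degree_tail α
  rw [degree_eq_of_mem_support hq hα] at hd
  rw [dehomogenize_monomial, homogeneousComponent_of_mem ((mem_homogeneousSubmodule _ _).mpr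
    (isHomogeneous_monomial _ rfl)), eval_monomial, Finsupp.prod_fintype _ _ (by simp),
    Fin.prod_univ_succ, Fin.cons_zero]
  by_cases h : α 0 = 0
  · rw [if_pos (by omega), eval_monomial, Finsupp.prod_fintype _ _ (by simp), h, pow_zero, one_mul]
    simp [Finsupp.tail_apply]
  · rw [if_neg (by omega), zero_pow h, map_zero]
    ring

/-- The homogenization of an element of I cuts out a variety containing V and restricts to its top
form on z_0 = 0. Conversely, an equation of degree k of a variety containing V dehomogenizes to an
element of I whose degree-k component is the restriction of that equation to z_0 = 0. -/
theorem pointAtInfinity_mem_projClosure_iff {N : ℕ} (V : Set (Fin N → ℂ)) (w : Fin N → ℂ)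
    (hw : w ≠ 0) :
    pointAtInfinity w hw ∈ projClosure V ↔
      ∀ n, ∀ f ∈ initialForms (idealOf V) n, eval w f = 0 := by
  constructor
  · intro h n f hf
    obtain ⟨p, hp, hd, rfl⟩ := mem_initialForms.mp hf
    have hmem := h {x | eval x.rep (homogenize n p) = 0} ⟨⟨{homogenize n p},
      by simpa using ⟨n, isHomogeneous_homogenize n p⟩, by simp⟩, ?_⟩
    · rw [← eval_zero_homogenize]
      exact (eval_rep_mk_eq_zero_iff (isHomogeneous_homogenize n p) _ _).mp hmem
    · rintro _ ⟨z, hz, rfl⟩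
      refine (eval_rep_mk_eq_zero_iff (isHomogeneous_homogenize n p) _ _).mpr ?_
      rw [eval_one_homogenize hd]
      simpa using hp z hz
  · rintro h S ⟨⟨Q, hQ, rfl⟩, hVS⟩ q hq
    obtain ⟨k, hk⟩ := hQ q hq
    refine (eval_rep_mk_eq_zero_iff hk _ _).mpr ?_
    rw [← eval_homogeneousComponent_dehomogenize hk]
    refine h k _ (mem_initialForms.mpr ⟨_, ?_, totalDegree_dehomogenize_le hk, rfl⟩)
    intro z hz
    have := (eval_rep_mk_eq_zero_iff hk _ _).mp (hVS ⟨z, hz, rfl⟩ q hq)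
    rw [← eval_dehomogenize] at this
    simpa using this

/-! ### Multiplication by a linear form without zeros at infinity -/

/-- The ideal in(I) + (l) has no zero outside the origin, so by the Nullstellensatz it contains a
power of every variable, hence every form of large degree. The component of degree n + 1 of such a
membership gives g. -/
theorem eventually_exists_sub_mul_mem {N : ℕ} {I : Ideal (MvPolynomial (Fin N) ℂ)}
    {l : MvPolynomial (Fin N) ℂ} (hl : l.IsHomogeneous 1)
    (h : ∀ w : Fin N → ℂ, w ≠ 0 → (∀ n, ∀ f ∈ initialForms I n, eval w f = 0) → eval w l ≠ 0) :
    ∀ᶠ n : ℕ in Filter.atTop, ∀ f : MvPolynomial (Fin N) ℂ, f.IsHomogeneous (n + 1) →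
      ∃ g : MvPolynomial (Fin N) ℂ, g.IsHomogeneous n ∧ f - l * g ∈ initialForms I (n + 1) := by
  set 𝔞 := initialIdeal I ⊔ Ideal.span {l} with h𝔞
  have hX : ∀ i : Fin N, ∃ m, (X i : MvPolynomial (Fin N) ℂ) ^ m ∈ 𝔞 := by
    intro i
    rw [← Ideal.mem_radical_iff, ← vanishingIdeal_zeroLocus_eq_radical (K := ℂ)]
    intro w hw
    have hw0 : w = 0 := by
      by_contra hne
      refine h w hne (fun n f hf => ?_) ?_
      · simpa using hw f (Ideal.mem_sup_left (initialForms_le_initialIdeal hf))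
      · simpa using hw l (Ideal.mem_sup_right (Ideal.mem_span_singleton_self l))
    simp [hw0]
  choose m hm using hX
  filter_upwards [Filter.eventually_ge_atTop (∑ i, m i)] with n hn f hf
  have hmem : f ∈ 𝔞 := by
    rw [f.as_sum]
    refine Ideal.sum_mem _ fun α hα => ?_
    -- Pigeonhole: the degree n + 1 exceeds the sum of the exponents `m i`.
    obtain ⟨i, hi⟩ : ∃ i, m i ≤ α i := by
      by_contra! hcon
      have h1 := degree_eq_of_mem_support hf hα
      rw [Finsupp.degree_eq_sum] at h1
      have h2 : ∑ i, α i ≤ ∑ i, m i := Finset.sum_le_sum fun i _ => (hcon i).le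
      omega
    have hle : Finsupp.single i (m i) ≤ α := by simpa using hi
    rw [← add_tsub_cancel_of_le hle, ← mul_one (coeff _ f), mul_comm (coeff _ f), ← monomial_mul,
      ← X_pow_eq_monomial]
    exact Ideal.mul_mem_right _ _ (hm i)
  obtain ⟨a, ha, b, hb, rfl⟩ := Submodule.mem_sup.mp hmem
  obtain ⟨c, rfl⟩ := Ideal.mem_span_singleton'.mp hb
  refine ⟨homogeneousComponent n c, homogeneousComponent_isHomogeneous n c, ?_⟩
  have hlc := homogeneousComponent_mul_of_isHomogeneous hl (n + 1) c
  rw [if_pos (by omega), Nat.add_sub_cancel] at hlc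
  rw [← homogeneousComponent_eq_self hf, map_add, mul_comm c, hlc, add_sub_cancel_right]
  exact ha (n + 1)

/-- The span of the basis monomials of degree `n`. -/
abbrev standardForms {N : ℕ} (I : Ideal (MvPolynomial (Fin N) ℂ)) (n : ℕ) :
    Submodule ℂ (MvPolynomial (Fin N) ℂ) :=
  restrictSupport ℂ (standardExponentsOfDegree I n : Set (Fin N →₀ ℕ))

theorem mem_standardForms_iff {N : ℕ} {I : Ideal (MvPolynomial (Fin N) ℂ)} {n : ℕ}
    {q : MvPolynomial (Fin N) ℂ} :
    q ∈ standardForms I n ↔ q.IsHomogeneous n ∧ ∀ α ∈ q.support, α ∈ standardExponents I := by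
  constructor
  · intro h
    refine ⟨fun α hα => ?_, fun α hα => (mem_standardExponentsOfDegree.mp (h hα)).2⟩
    have := (mem_standardExponentsOfDegree.mp (h (mem_support_iff.mpr hα))).1
    rwa [Finsupp.degree_eq_weight_one] at this
  · intro h α hα
    exact mem_standardExponentsOfDegree.mpr ⟨degree_eq_of_mem_support h.1 hα, h.2 α hα⟩

theorem normalPart_mem_standardForms {N : ℕ} (I : Ideal (MvPolynomial (Fin N) ℂ)) (n : ℕ)
    (f : MvPolynomial (Fin N) ℂ) : normalPart I n f ∈ standardForms I n :=
  mem_standardForms_iff.mpr ⟨isHomogeneous_normalPart I n f, fun _ hα =>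
    mem_standardExponents_of_mem_support_normalPart hα⟩

/-- Multiplication by l followed by reduction is a surjective map between spaces of standard forms
of equal finite dimension, hence injective. -/
theorem eq_zero_of_mul_mem_initialForms {N : ℕ} {I : Ideal (MvPolynomial (Fin N) ℂ)} {n : ℕ}
    {l : MvPolynomial (Fin N) ℂ} (hl : l.IsHomogeneous 1)
    (hcard : (standardExponentsOfDegree I n).card = (standardExponentsOfDegree I (n + 1)).card)
    (h : ∀ f : MvPolynomial (Fin N) ℂ, f.IsHomogeneous (n + 1) →
      ∃ g : MvPolynomial (Fin N) ℂ, g.IsHomogeneous n ∧ f - l * g ∈ initialForms I (n + 1))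
    {q : MvPolynomial (Fin N) ℂ} (hq : q ∈ standardForms I n)
    (hlq : l * q ∈ initialForms I (n + 1)) : q = 0 := by
  have := finite_restrictSupport (standardExponentsOfDegree I n)
  have := finite_restrictSupport (standardExponentsOfDegree I (n + 1))
  have hmul : ∀ {g : MvPolynomial (Fin N) ℂ}, g.IsHomogeneous n → (l * g).IsHomogeneous (n + 1) :=
    fun hg => by simpa [add_comm] using hl.mul hg
  let T : standardForms I n →ₗ[ℂ] standardForms I (n + 1) :=
    LinearMap.codRestrict _ (normalPart I (n + 1) ∘ₗ LinearMap.mulLeft ℂ l ∘ₗ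
      (standardForms I n).subtype) fun g => normalPart_mem_standardForms I _ _
  have hT : ∀ g : standardForms I n, (T g : MvPolynomial (Fin N) ℂ) =
    normalPart I (n + 1) (l * g) := fun g => rfl
  have hsurj : Function.Surjective T := by
    rintro ⟨r, hr⟩
    obtain ⟨hr1, hr2⟩ := mem_standardForms_iff.mp hr
    obtain ⟨g, hg, hgr⟩ := h r hr1
    refine ⟨⟨normalPart I n g, normalPart_mem_standardForms I n g⟩, Subtype.ext ?_⟩
    rw [hT]
    refine normalPart_eq (hmul (isHomogeneous_normalPart I n g)) ?_ hr2
    have h1 := mul_mem_initialForms hl (sub_normalPart_mem I hg)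
    rw [add_comm] at h1
    have h2 := neg_mem (add_mem hgr h1)
    convert h2 using 1
    ring
  have hinj : Function.Injective T :=
    (LinearMap.injective_iff_surjective_of_finrank_eq_finrank (by
      rw [finrank_restrictSupport, finrank_restrictSupport, hcard])).mpr hsurj
  have h0 : T ⟨q, hq⟩ = T 0 := by
    rw [map_zero]
    exact Subtype.ext ((normalPart_eq_zero_iff
      (hmul (mem_standardForms_iff.mp hq).1)).mpr hlq)
  exact congrArg Subtype.val (hinj h0)

/-! ### The listed basis -/

theorem exists_listedExponent_eq {N : ℕ} {I : Ideal (MvPolynomial (Fin N) ℂ)} {n d : ℕ}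
    (h : (standardExponentsOfDegree I n).card = d) {α : Fin N →₀ ℕ}
    (hα : α ∈ standardExponentsOfDegree I n) : ∃ i, listedExponent I n h i = α := by
  classical
  have himg : Finset.univ.image (listedExponent I n h) = standardExponentsOfDegree I n := by
    refine Finset.eq_of_subset_of_card_le ?_ ?_
    · intro β hβ
      obtain ⟨i, -, rfl⟩ := Finset.mem_image.mp hβ
      exact listedExponent_mem I n h i
    · rw [Finset.card_image_of_injective _ (listedExponent_injective I n h), h]
      simp
  rw [← himg] at hα
  simpa using hα

theorem listedExponent_lt_iff {N : ℕ} {I : Ideal (MvPolynomial (Fin N) ℂ)} {n d : ℕ}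
    (h : (standardExponentsOfDegree I n).card = d) (i k : Fin d) :
    GrevlexLT (listedExponent I n h i) (listedExponent I n h k) ↔ i < k :=
  (((standardExponentsOfDegree I n).map (grevlex N).toSyn.toEquiv.toEmbedding).orderEmbOfFin
    (by rw [Finset.card_map, h])).lt_iff_lt (a := i) (b := k)

-- Expresses a position in the list as a count, so that positions in different degrees can be
-- compared by a bijection of predecessors.
open Classical in
theorem card_filter_lt_listedExponent {N : ℕ} {I : Ideal (MvPolynomial (Fin N) ℂ)} {n d : ℕ}
    (h : (standardExponentsOfDegree I n).card = d) (i : Fin d) :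
    ((standardExponentsOfDegree I n).filter
      fun β => GrevlexLT β (listedExponent I n h i)).card = i := by
  have : (standardExponentsOfDegree I n).filter (fun β => GrevlexLT β (listedExponent I n h i)) =
      (Finset.Iio i).image (listedExponent I n h) := by
    ext β
    rw [Finset.mem_filter, Finset.mem_image]
    constructor
    · rintro ⟨hβ, hlt⟩
      obtain ⟨k, rfl⟩ := exists_listedExponent_eq h hβ
      exact ⟨k, Finset.mem_Iio.mpr ((listedExponent_lt_iff h k i).mp hlt), rfl⟩
    · rintro ⟨k, hk, rfl⟩
      exact ⟨listedExponent_mem I n h k, (listedExponent_lt_iff h k i).mpr (Finset.mem_Iio.mp hk)⟩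
  rw [this, Finset.card_image_of_injective _ (listedExponent_injective I n h), Fin.card_Iio]

theorem le_of_grevlexLT {N : ℕ} [NeZero N] {α β : Fin N →₀ ℕ} (h : GrevlexLT α β)
    (hd : α.degree = β.degree) : β 0 ≤ α 0 := by
  rcases h with h | ⟨-, i, hi, hi'⟩
  · omega
  · rcases (Fin.zero_le i).eq_or_lt with h | h
    · rw [← h] at hi
      exact hi.le
    · exact (hi' 0 h).ge

/-- Multiplication by `z_1` identifies the basis monomials of degree `n` divisible by `z_1^K` with
those of degree `n + 1`. -/
def StableAbove {N : ℕ} [NeZero N] (I : Ideal (MvPolynomial (Fin N) ℂ)) (K n : ℕ) : Prop :=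
  (∀ α ∈ standardExponentsOfDegree I n, K ≤ α 0 →
    α + Finsupp.single 0 1 ∈ standardExponentsOfDegree I (n + 1)) ∧
  ∀ β ∈ standardExponentsOfDegree I (n + 1), K ≤ β 0 →
    ∃ α ∈ standardExponentsOfDegree I n, K ≤ α 0 ∧ β = α + Finsupp.single 0 1

/-- At fixed degree, higher powers of z_1 come earlier in the list. All predecessors of a monomial
divisible by z_1^K are therefore divisible by z_1^K too, and multiplication by z_1 is an
order-preserving bijection onto the predecessors of its image. This makes the row and column indices
of `[[z_j]]` match. -/
theorem listedExponent_succ {N : ℕ} [NeZero N] {I : Ideal (MvPolynomial (Fin N) ℂ)} {K n d : ℕ}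
    (hs : StableAbove I K n) (h₀ : (standardExponentsOfDegree I n).card = d)
    (h₁ : (standardExponentsOfDegree I (n + 1)).card = d) {i : Fin d}
    (hi : K ≤ listedExponent I n h₀ i 0) :
    listedExponent I (n + 1) h₁ i = listedExponent I n h₀ i + Finsupp.single 0 1 := by
  classical
  set α := listedExponent I n h₀ i with hα
  have hαm : α ∈ standardExponentsOfDegree I n := listedExponent_mem I n h₀ i
  obtain ⟨k, hk⟩ := exists_listedExponent_eq h₁ (hs.1 α hαm hi)
  have hki : k = i := by
    refine Fin.ext ?_
    rw [← card_filter_lt_listedExponent h₁ k, ← card_filter_lt_listedExponent h₀ i, hk, ← hα]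
    refine Eq.trans (congrArg Finset.card ?_) (Finset.card_image_of_injective _
      (add_left_injective (Finsupp.single (0 : Fin N) 1)))
    ext β
    simp only [Finset.mem_filter, Finset.mem_image]
    have hshift : ∀ γ : Fin N →₀ ℕ, GrevlexLT (γ + Finsupp.single 0 1)
        (α + Finsupp.single 0 1) ↔ GrevlexLT γ α := by
      intro γ
      have hadd : ∀ {γ δ : Fin N →₀ ℕ}, GrevlexLT γ δ →
          GrevlexLT (γ + Finsupp.single 0 1) (δ + Finsupp.single 0 1) := fun h => by
        rw [add_comm, add_comm _ (Finsupp.single 0 1)]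
        exact h.add_left _
      refine ⟨fun h => ?_, hadd⟩
      rcases GrevlexLT.trichotomy γ α with h' | h' | h'
      · exact h'
      · exact absurd h (h' ▸ GrevlexLT.irrefl _)
      · exact absurd (h.trans (hadd h')) (GrevlexLT.irrefl _)
    constructor
    · rintro ⟨hβ, hlt⟩
      have hle := le_of_grevlexLT hlt ((mem_standardExponentsOfDegree.mp hβ).1.trans
        (mem_standardExponentsOfDegree.mp (hs.1 α hαm hi)).1.symm)
      rw [Finsupp.add_apply] at hle
      obtain ⟨γ, hγ, -, rfl⟩ := hs.2 β hβ (by omega)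
      exact ⟨γ, ⟨hγ, (hshift γ).mp hlt⟩, rfl⟩
    · rintro ⟨γ, ⟨hγ, hlt⟩, rfl⟩
      have hle := le_of_grevlexLT hlt ((mem_standardExponentsOfDegree.mp hγ).1.trans
        (mem_standardExponentsOfDegree.mp hαm).1.symm)
      exact ⟨hs.1 γ hγ (hi.trans hle), (hshift γ).mpr hlt⟩
  rw [← hk, hki]

theorem le_listedExponent_of_succ {N : ℕ} [NeZero N] {I : Ideal (MvPolynomial (Fin N) ℂ)}
    {K n d : ℕ} (hs : StableAbove I K n) (h₀ : (standardExponentsOfDegree I n).card = d)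
    (h₁ : (standardExponentsOfDegree I (n + 1)).card = d) {i : Fin d}
    (hi : K ≤ listedExponent I (n + 1) h₁ i 0) : K ≤ listedExponent I n h₀ i 0 := by
  obtain ⟨α, hα, hK, e⟩ := hs.2 _ (listedExponent_mem I (n + 1) h₁ i) hi
  obtain ⟨k, rfl⟩ := exists_listedExponent_eq h₀ hα
  rw [← listedExponent_succ hs h₀ h₁ hK] at e
  rwa [listedExponent_injective I (n + 1) h₁ e]

/-- The colon ideals of the leading-term ideal by z_1^k increase with k, so they stabilize by
Noetherianity; K is where they do. -/
theorem exists_forall_add_mem_standardExponents {N : ℕ} [NeZero N]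
    (I : Ideal (MvPolynomial (Fin N) ℂ)) :
    ∃ K : ℕ, ∀ α : Fin N →₀ ℕ, α + Finsupp.single 0 K ∈ standardExponents I →
      α + Finsupp.single 0 (K + 1) ∈ standardExponents I := by
  let F : ℕ →o Ideal (MvPolynomial (Fin N) ℂ) :=
    { toFun := fun k => (ltIdeal I).colon {X 0 ^ k}
      monotone' := by
        refine monotone_nat_of_le_succ fun k f hf => ?_
        rw [Submodule.mem_colon_singleton, smul_eq_mul] at hf ⊢
        rw [pow_succ, ← mul_assoc]
        exact Ideal.mul_mem_right _ _ hf }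
  obtain ⟨K, hK⟩ := monotone_stabilizes_iff_noetherian.mpr
    (inferInstanceAs (IsNoetherianRing (MvPolynomial (Fin N) ℂ))) F
  have hF : ∀ (α : Fin N →₀ ℕ) (k : ℕ),
      α + Finsupp.single 0 k ∈ standardExponents I ↔ monomial α (1 : ℂ) ∉ F k := by
    intro α k
    change _ ∉ _ ↔ monomial α (1 : ℂ) ∉ (ltIdeal I).colon {X 0 ^ k}
    rw [Submodule.mem_colon_singleton, smul_eq_mul, X_pow_eq_monomial, monomial_mul, one_mul]
  refine ⟨K, fun α hα => ?_⟩
  rw [hF] at hα ⊢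
  rwa [← hK (K + 1) (by omega)]

/-- Multiplication by z_1 injects the standard monomials divisible by z_1^K into those of the next
degree. Their number is nondecreasing and at most d, hence eventually constant, and the injection
becomes a bijection. -/
theorem exists_eventually_stableAbove {N : ℕ} [NeZero N] {I : Ideal (MvPolynomial (Fin N) ℂ)}
    {d : ℕ} (hd : ∀ᶠ n : ℕ in Filter.atTop, (standardExponentsOfDegree I n).card = d) :
    ∃ K : ℕ, ∀ᶠ n : ℕ in Filter.atTop, StableAbove I K n := by
  classical
  obtain ⟨K, hK⟩ := exists_forall_add_mem_standardExponents I
  refine ⟨K, ?_⟩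
  have hstep : ∀ n, ∀ α ∈ standardExponentsOfDegree I n, K ≤ α 0 →
      α + Finsupp.single 0 1 ∈ standardExponentsOfDegree I (n + 1) := by
    intro n α hα hKα
    obtain ⟨h1, h2⟩ := mem_standardExponentsOfDegree.mp hα
    refine mem_standardExponentsOfDegree.mpr ⟨by simp [h1], ?_⟩
    have hle : Finsupp.single 0 K ≤ α := by simpa using hKα
    have := hK (α - Finsupp.single 0 K) (by rwa [tsub_add_cancel_of_le hle])
    rwa [Finsupp.single_add, ← add_assoc, tsub_add_cancel_of_le hle] at this
  let S : ℕ → Finset (Fin N →₀ ℕ) := fun n =>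
    (standardExponentsOfDegree I n).filter fun α => K ≤ α 0
  have hsub : ∀ n, (S n).image (· + Finsupp.single 0 1) ⊆ S (n + 1) := by
    intro n β hβ
    obtain ⟨α, hα, rfl⟩ := Finset.mem_image.mp hβ
    obtain ⟨h1, h2⟩ := Finset.mem_filter.mp hα
    refine Finset.mem_filter.mpr ⟨hstep n α h1 h2, ?_⟩
    rw [Finsupp.add_apply]
    omega
  have himg : ∀ n, ((S n).image (· + Finsupp.single 0 1)).card = (S n).card := fun n =>
    Finset.card_image_of_injective _ (add_left_injective _)
  have hmono : Monotone fun n => (S n).card :=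
    monotone_nat_of_le_succ fun n => (himg n) ▸ Finset.card_le_card (hsub n)
  obtain ⟨n₁, hn₁⟩ := Filter.eventually_atTop.mp hd
  have hbound : ∀ n, (S n).card ≤ d := fun n =>
    (hmono (le_max_left n n₁)).trans
      ((Finset.card_filter_le _ _).trans (hn₁ _ (le_max_right n n₁)).le)
  -- Minimizing d - |S n| maximizes |S n|, since `hbound` rules out truncation; by monotonicity the
  -- size is constant from the minimizer on.
  have hmin := fun n => Function.argmin_le (fun n => d - (S n).card) n
  set n₀ := Function.argmin (fun n => d - (S n).card)
  filter_upwards [Filter.eventually_ge_atTop n₀] with n hn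
  refine ⟨hstep n, fun β hβ hKβ => ?_⟩
  have heq : (S n).image (· + Finsupp.single 0 1) = S (n + 1) := by
    refine Finset.eq_of_subset_of_card_le (hsub n) ?_
    rw [himg]
    have h1 := hmin (n + 1)
    have h2 := hmono hn
    have h3 := hbound (n + 1)
    have h4 := hbound n
    simp only at h1 h2
    omega
  have hβS : β ∈ S (n + 1) := Finset.mem_filter.mpr ⟨hβ, hKβ⟩
  rw [← heq] at hβS
  obtain ⟨α, hα, rfl⟩ := Finset.mem_image.mp hβS
  obtain ⟨h1, h2⟩ := Finset.mem_filter.mp hα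
  exact ⟨α, h1, h2, rfl⟩

/-! ### The multiplication matrices -/

theorem mulMatrix_apply {N : ℕ} (I : Ideal (MvPolynomial (Fin N) ℂ)) (j : Fin N) (n : ℕ) {d : ℕ}
    (h₀ : (standardExponentsOfDegree I n).card = d)
    (h₁ : (standardExponentsOfDegree I (n + 1)).card = d) (i k : Fin d) :
    mulMatrix I j n h₀ h₁ i k = coeff (listedExponent I (n + 1) h₁ i)
      (normalPart I (n + 1) (X j * monomial (listedExponent I n h₀ k) 1)) := by
  rw [mulMatrix, Matrix.of_apply, coordVec, hatMul_X_eq I j n _ (isHomogeneous_monomial _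
    (mem_standardExponentsOfDegree.mp (listedExponent_mem I n h₀ k)).1), normalPart_apply]

theorem coeff_eq_zero_of_mem_standardForms {N : ℕ} {I : Ideal (MvPolynomial (Fin N) ℂ)} {n : ℕ}
    {q : MvPolynomial (Fin N) ℂ} (hq : q ∈ standardForms I n) {α : Fin N →₀ ℕ}
    (hα : α ∉ standardExponentsOfDegree I n) : coeff α q = 0 :=
  notMem_support_iff.mp fun h => hα (hq h)

theorem monomial_mem_standardForms {N : ℕ} {I : Ideal (MvPolynomial (Fin N) ℂ)} {n : ℕ}
    {α : Fin N →₀ ℕ} (hα : α ∈ standardExponentsOfDegree I n) (c : ℂ) :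
    monomial α c ∈ standardForms I n := by
  obtain ⟨h1, h2⟩ := mem_standardExponentsOfDegree.mp hα
  refine mem_standardForms_iff.mpr ⟨isHomogeneous_monomial _ h1, fun β hβ => ?_⟩
  rwa [Finset.mem_singleton.mp (support_monomial_subset hβ)]

theorem coordVec_injOn {N : ℕ} {I : Ideal (MvPolynomial (Fin N) ℂ)} {n d : ℕ}
    (h : (standardExponentsOfDegree I n).card = d) {p q : MvPolynomial (Fin N) ℂ}
    (hp : p ∈ standardForms I n) (hq : q ∈ standardForms I n)
    (hpq : coordVec I n h p = coordVec I n h q) : p = q := by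
  ext α
  by_cases hα : α ∈ standardExponentsOfDegree I n
  · obtain ⟨i, rfl⟩ := exists_listedExponent_eq h hα
    exact congrFun hpq i
  · rw [coeff_eq_zero_of_mem_standardForms hp hα, coeff_eq_zero_of_mem_standardForms hq hα]

theorem exists_coordVec_eq {N : ℕ} {I : Ideal (MvPolynomial (Fin N) ℂ)} {n d : ℕ}
    (h : (standardExponentsOfDegree I n).card = d) (v : Fin d → ℂ) :
    ∃ q ∈ standardForms I n, coordVec I n h q = v := by
  classical
  refine ⟨∑ k, monomial (listedExponent I n h k) (v k), sum_mem fun k _ =>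
    monomial_mem_standardForms (listedExponent_mem I n h k) _, ?_⟩
  funext i
  rw [coordVec, coeff_sum, Finset.sum_eq_single i]
  · rw [coeff_monomial, if_pos rfl]
  · intro k _ hk
    rw [coeff_monomial, if_neg fun e => hk (listedExponent_injective I n h e)]
  · intro hi
    exact absurd (Finset.mem_univ i) hi

theorem eval_eq_sum_coordVec {N : ℕ} {I : Ideal (MvPolynomial (Fin N) ℂ)} {n d : ℕ}
    (h : (standardExponentsOfDegree I n).card = d) {q : MvPolynomial (Fin N) ℂ}
    (hq : q ∈ standardForms I n) (w : Fin N → ℂ) :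
    eval w q = ∑ i, coordVec I n h q i * ∏ j, w j ^ listedExponent I n h i j := by
  classical
  have hq' : q = ∑ k, monomial (listedExponent I n h k) (coordVec I n h q k) := by
    ext α
    rw [coeff_sum]
    simp_rw [coeff_monomial]
    by_cases hα : α ∈ standardExponentsOfDegree I n
    · obtain ⟨i, rfl⟩ := exists_listedExponent_eq h hα
      rw [Finset.sum_eq_single i]
      · rw [if_pos rfl, coordVec]
      · intro k _ hk
        rw [if_neg fun e => hk (listedExponent_injective I n h e)]
      · intro hi
        exact absurd (Finset.mem_univ i) hi
    · rw [coeff_eq_zero_of_mem_standardForms hq hα, Finset.sum_eq_zero]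
      intro k _
      rw [if_neg]
      rintro rfl
      exact hα (listedExponent_mem I n h k)
  conv_lhs => rw [hq']
  rw [map_sum]
  refine Finset.sum_congr rfl fun i _ => ?_
  rw [eval_monomial, Finsupp.prod_fintype _ _ (by simp)]

theorem mulMatrix_mulVec {N : ℕ} {I : Ideal (MvPolynomial (Fin N) ℂ)} (j : Fin N) {n d : ℕ}
    (h₀ : (standardExponentsOfDegree I n).card = d)
    (h₁ : (standardExponentsOfDegree I (n + 1)).card = d) {q : MvPolynomial (Fin N) ℂ}
    (hq : q ∈ standardForms I n) :
    (mulMatrix I j n h₀ h₁).mulVec (coordVec I n h₀ q) =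
      coordVec I (n + 1) h₁ (normalPart I (n + 1) (X j * q)) := by
  obtain ⟨h1, h2⟩ := mem_standardForms_iff.mp hq
  rw [mulMatrix_mulVec_coordVec I j n h₀ h₁ q h1 h2, hatMul_X_eq I j n q h1, normalPart_apply]

/-! ### Eigenvalues of block triangular matrices -/

theorem hasEigenvalue_of_det_eq_zero {d : ℕ} {M : Matrix (Fin d) (Fin d) ℂ} {l : ℂ}
    (h : (M - l • 1).det = 0) : Module.End.HasEigenvalue (Matrix.toLin' M) l := by
  obtain ⟨v, hv, hMv⟩ := Matrix.exists_mulVec_eq_zero_iff.mpr h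
  refine Module.End.hasEigenvalue_of_hasEigenvector (x := v)
    (Module.End.hasEigenvector_iff.mpr ⟨Module.End.mem_eigenspace_iff.mpr ?_, hv⟩)
  rw [Matrix.sub_mulVec, Matrix.smul_mulVec, Matrix.one_mulVec, sub_eq_zero] at hMv
  rwa [Matrix.toLin'_apply]

/-- A left eigenvector of a diagonal block of a block triangular matrix gives an eigenvalue. -/
theorem hasEigenvalue_of_block {d : ℕ} {M : Matrix (Fin d) (Fin d) ℂ} {l : ℂ} (p : Fin d → Prop)
    (hM : ∀ i, ¬ p i → ∀ k, p k → M i k = 0) (u : Fin d → ℂ)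
    (hu : ∀ k, p k → ∑ i, u i * M i k = l * u k) (hne : ∃ k, p k ∧ u k ≠ 0) :
    Module.End.HasEigenvalue (Matrix.toLin' M) l := by
  classical
  refine hasEigenvalue_of_det_eq_zero ?_
  rw [Matrix.twoBlockTriangular_det _ p, mul_eq_zero]
  · left
    obtain ⟨k₀, hk₀, hk₀'⟩ := hne
    refine Matrix.exists_vecMul_eq_zero_iff.mp ⟨fun i => u i,
      fun h => hk₀' (congrFun h ⟨k₀, hk₀⟩), ?_⟩
    funext ⟨k, hk⟩
    -- Rows outside the block vanish on its columns, so the full sum in `hu` is a sum over the block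
    -- and u restricts to a left null vector of M - l on the block.
    have h1 : ∑ i : {i // p i}, u i * M i k = l * u k := by
      rw [← hu k hk, ← Fintype.sum_subtype_add_sum_subtype p fun i => u i * M i k]
      rw [left_eq_add]
      exact Finset.sum_eq_zero fun i _ => by rw [hM i i.2 k hk, mul_zero]
    change ∑ i : {i // p i}, u i * (M i k - (l • (1 : Matrix (Fin d) (Fin d) ℂ)) i k) = 0
    simp only [mul_sub, Finset.sum_sub_distrib]
    rw [h1, Finset.sum_eq_single ⟨k, hk⟩]
    · simp [mul_comm]
    · intro i _ hi
      rw [Matrix.smul_apply, Matrix.one_apply_ne fun e => hi (Subtype.ext e), smul_zero, mul_zero]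
    · intro h
      exact absurd (Finset.mem_univ _) h
  · intro i hi k hk
    have : i ≠ k := by
      rintro rfl
      exact hi hk
    simp [hM i hi k hk, Matrix.one_apply_ne this]

/-! ### Eigenvalues from points at infinity -/

theorem eval_normalPart {N : ℕ} {I : Ideal (MvPolynomial (Fin N) ℂ)} {n : ℕ}
    {f : MvPolynomial (Fin N) ℂ} (hf : f.IsHomogeneous n) {w : Fin N → ℂ}
    (hw : ∀ n, ∀ f ∈ initialForms I n, eval w f = 0) :
    eval w (normalPart I n f) = eval w f := by
  have := hw n _ (sub_normalPart_mem I hf)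
  rw [map_sub, sub_eq_zero] at this
  exact this.symm

/-- The power z_1^n does not vanish at w, so its reduction is nonzero; every monomial in that
reduction is divisible by z_1^n. -/
theorem single_mem_standardExponentsOfDegree {N : ℕ} [NeZero N]
    {I : Ideal (MvPolynomial (Fin N) ℂ)} {w : Fin N → ℂ}
    (hw : ∀ n, ∀ f ∈ initialForms I n, eval w f = 0) (h0 : w 0 ≠ 0) (n : ℕ) :
    Finsupp.single 0 n ∈ standardExponentsOfDegree I n := by
  have hhom : (X 0 ^ n : MvPolynomial (Fin N) ℂ).IsHomogeneous n := isHomogeneous_X_pow _ _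
  have hev := eval_normalPart hhom hw
  have hne : normalPart I n (X 0 ^ n) ≠ 0 := by
    intro h
    rw [h, map_zero, map_pow, eval_X] at hev
    exact pow_ne_zero n h0 hev.symm
  obtain ⟨α, hα⟩ := support_nonempty.mpr hne
  have hle : n ≤ α 0 := by
    refine le_of_mem_support_normalPart hhom (fun β hβ => ?_) hα
    rw [X_pow_eq_monomial] at hβ
    rw [Finset.mem_singleton.mp (support_monomial_subset hβ), Finsupp.single_eq_same]
  refine mem_standardExponentsOfDegree.mpr ⟨by simp, ?_⟩
  exact standardExponents_of_le (mem_standardExponents_of_mem_support_normalPart hα)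
    (by simpa using hle)

/-- The block consists of the indices whose monomial is divisible by z_1^K, and the left eigenvector
is the vector of values at w of the degree-n basis monomials. -/
theorem hasEigenvalue_of_point {N : ℕ} [NeZero N] {I : Ideal (MvPolynomial (Fin N) ℂ)}
    {K n d : ℕ} (hs : StableAbove I K n) (hK : K ≤ n)
    (h₀ : (standardExponentsOfDegree I n).card = d)
    (h₁ : (standardExponentsOfDegree I (n + 1)).card = d) {w : Fin N → ℂ}
    (hw : ∀ n, ∀ f ∈ initialForms I n, eval w f = 0) (hw0 : w 0 = 1) (j : Fin N) :
    Module.End.HasEigenvalue (Matrix.toLin' (mulMatrix I j n h₀ h₁)) (w j) := by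
  have hhom : ∀ k, (X j * monomial (listedExponent I n h₀ k) (1 : ℂ)).IsHomogeneous (n + 1) := by
    intro k
    rw [add_comm]
    exact (isHomogeneous_X ℂ j).mul (isHomogeneous_monomial _
      (mem_standardExponentsOfDegree.mp (listedExponent_mem I n h₀ k)).1)
  have hzero : ∀ i, ¬ K ≤ listedExponent I n h₀ i 0 → ∀ k, K ≤ listedExponent I n h₀ k 0 →
      mulMatrix I j n h₀ h₁ i k = 0 := by
    intro i hi k hk
    rw [mulMatrix_apply]
    by_contra hne
    refine hi (le_listedExponent_of_succ hs h₀ h₁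
      (le_of_mem_support_normalPart (hhom k) (fun α hα => ?_) (mem_support_iff.mpr hne)))
    rw [X, monomial_mul] at hα
    rw [Finset.mem_singleton.mp (support_monomial_subset hα), Finsupp.add_apply]
    omega
  refine hasEigenvalue_of_block (fun i => K ≤ listedExponent I n h₀ i 0) hzero
    (fun i => ∏ j, w j ^ listedExponent I n h₀ i j) (fun k hk => ?_) ?_
  · have h1 := eval_eq_sum_coordVec h₁ (normalPart_mem_standardForms I (n + 1)
      (X j * monomial (listedExponent I n h₀ k) (1 : ℂ))) w
    rw [eval_normalPart (hhom k) hw, map_mul, eval_X, eval_monomial, one_mul,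
      Finsupp.prod_fintype _ _ (by simp)] at h1
    rw [h1]
    refine Finset.sum_congr rfl fun i _ => ?_
    rw [coordVec, ← mulMatrix_apply, mul_comm]
    -- On the block the two basis monomials of index i differ by the factor z_1, whose value at w is
    -- 1; off the block the matrix entry is zero.
    by_cases hi : K ≤ listedExponent I n h₀ i 0
    · rw [listedExponent_succ hs h₀ h₁ hi]
      congr 1
      refine Finset.prod_congr rfl fun m _ => ?_
      rw [Finsupp.add_apply, pow_add]
      by_cases hm : m = 0
      · rw [hm, hw0]
        simp
      · rw [Finsupp.single_eq_of_ne hm, pow_zero, mul_one]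
    · rw [hzero i hi k hk, zero_mul, zero_mul]
  -- The monomial z_1^n lies in the block because K ≤ n, and its value at w is 1, so the eigenvector
  -- is nonzero there.
  · obtain ⟨k, hk⟩ := exists_listedExponent_eq h₀
      (single_mem_standardExponentsOfDegree hw (by rw [hw0]; exact one_ne_zero) n)
    refine ⟨k, ?_, ?_⟩
    · rw [hk, Finsupp.single_eq_same]
      exact hK
    · simp only [hk]
      refine Finset.prod_ne_zero_iff.mpr fun m _ => ?_
      by_cases hm : m = 0
      · rw [hm, hw0]
        simp
      · rw [Finsupp.single_eq_of_ne hm, pow_zero]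
        exact one_ne_zero

/-! ### Points at infinity from eigenvalues -/

/-- A standard monomial of degree n + 1 is congruent to some z_1 g, so it is the reduction of z_1 g
and is itself divisible by z_1. The basis in degree n + 1 is thus contained in z_1 times the basis
in degree n, with equality by counting. -/
theorem stableAbove_zero {N : ℕ} [NeZero N] {I : Ideal (MvPolynomial (Fin N) ℂ)} {n : ℕ}
    (hcard : (standardExponentsOfDegree I n).card = (standardExponentsOfDegree I (n + 1)).card)
    (h : ∀ f : MvPolynomial (Fin N) ℂ, f.IsHomogeneous (n + 1) →
      ∃ g : MvPolynomial (Fin N) ℂ, g.IsHomogeneous n ∧ f - X 0 * g ∈ initialForms I (n + 1)) :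
    StableAbove I 0 n := by
  classical
  have hdiv : ∀ β ∈ standardExponentsOfDegree I (n + 1),
      ∃ α ∈ standardExponentsOfDegree I n, β = α + Finsupp.single 0 1 := by
    intro β hβ
    obtain ⟨h1, h2⟩ := mem_standardExponentsOfDegree.mp hβ
    obtain ⟨g, hg, hβg⟩ := h (monomial β 1) (isHomogeneous_monomial _ h1)
    have hXg : (X 0 * g).IsHomogeneous (n + 1) := by
      rw [add_comm]
      exact (isHomogeneous_X ℂ 0).mul hg
    have hnf : normalPart I (n + 1) (X 0 * g) = monomial β 1 := by
      refine normalPart_eq hXg ?_ fun α hα => ?_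
      · rw [← neg_sub]
        exact neg_mem hβg
      · rwa [Finset.mem_singleton.mp (support_monomial_subset hα)]
    have h1β : 1 ≤ β 0 := by
      refine le_of_mem_support_normalPart hXg (fun α hα => ?_)
        (α := β) (I := I) (by rw [hnf, mem_support_iff, coeff_monomial, if_pos rfl]; exact one_ne_zero)
      rw [support_X_mul] at hα
      obtain ⟨γ, -, rfl⟩ := Finset.mem_map.mp hα
      simp
    have hle : Finsupp.single 0 1 ≤ β := by simpa using h1β
    refine ⟨β - Finsupp.single 0 1, mem_standardExponentsOfDegree.mpr
      ⟨?_, standardExponents_of_le h2 tsub_le_self⟩, (tsub_add_cancel_of_le hle).symm⟩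
    have := congrArg Finsupp.degree (tsub_add_cancel_of_le hle)
    rw [map_add, h1, Finsupp.degree_single] at this
    omega
  have heq : standardExponentsOfDegree I (n + 1) =
      (standardExponentsOfDegree I n).image (· + Finsupp.single 0 1) := by
    refine Finset.eq_of_subset_of_card_le (fun β hβ => ?_) (Finset.card_image_le.trans hcard.le)
    obtain ⟨α, hα, rfl⟩ := hdiv β hβ
    exact Finset.mem_image_of_mem _ hα
  refine ⟨fun α hα _ => heq ▸ Finset.mem_image_of_mem _ hα, fun β hβ _ => ?_⟩
  obtain ⟨α, hα, e⟩ := hdiv β hβ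
  exact ⟨α, hα, Nat.zero_le _, e⟩

theorem X_zero_mul_mem_standardForms {N : ℕ} [NeZero N] {I : Ideal (MvPolynomial (Fin N) ℂ)}
    {n : ℕ} (hs : StableAbove I 0 n) {q : MvPolynomial (Fin N) ℂ} (hq : q ∈ standardForms I n) :
    X 0 * q ∈ standardForms I (n + 1) := by
  intro α (hα : α ∈ (X 0 * q).support)
  rw [support_X_mul] at hα
  obtain ⟨β, hβ, rfl⟩ := Finset.mem_map.mp hα
  have := hs.1 β (hq hβ) (Nat.zero_le _)
  rwa [add_comm β] at this

/-- Without such a point, the linear form z_j - l z_1 vanishes nowhere at infinity, so it kills no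
nonzero standard form of high degree, yet it kills the one given by an eigenvector. A zero with w_1
≠ 0 is rescaled to w_1 = 1. -/
theorem exists_point_of_hasEigenvalue {N : ℕ} [NeZero N] {I : Ideal (MvPolynomial (Fin N) ℂ)}
    {d n₀ : ℕ} (hd : ∀ n, n₀ ≤ n → (standardExponentsOfDegree I n).card = d)
    (hs : ∀ n, n₀ ≤ n → StableAbove I 0 n)
    (hinf : ∀ w : Fin N → ℂ, w ≠ 0 → (∀ n, ∀ f ∈ initialForms I n, eval w f = 0) → w 0 ≠ 0)
    (j : Fin N) {n : ℕ} (hn : n₀ ≤ n) (h₀ : (standardExponentsOfDegree I n).card = d)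
    (h₁ : (standardExponentsOfDegree I (n + 1)).card = d) {l : ℂ}
    (hl : Module.End.HasEigenvalue (Matrix.toLin' (mulMatrix I j n h₀ h₁)) l) :
    ∃ w : Fin N → ℂ, w 0 = 1 ∧ (∀ n, ∀ f ∈ initialForms I n, eval w f = 0) ∧ w j = l := by
  by_contra! hcon
  set ℓ : MvPolynomial (Fin N) ℂ := X j - C l * X 0 with hℓ
  have hℓhom : ℓ.IsHomogeneous 1 := (isHomogeneous_X ℂ j).sub (isHomogeneous_C_mul_X l 0)
  have hne : ∀ w : Fin N → ℂ, w ≠ 0 → (∀ n, ∀ f ∈ initialForms I n, eval w f = 0) →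
      eval w ℓ ≠ 0 := by
    intro w hw hwI h0
    have hw0 := hinf w hw hwI
    refine hcon ((w 0)⁻¹ • w) (by simp [hw0]) (fun m f hf => ?_) ?_
    · rw [eval_smul_of_isHomogeneous (isHomogeneous_of_mem_initialForms hf), hwI m f hf, mul_zero]
    · simp only [hℓ, map_sub, map_mul, eval_X, eval_C, sub_eq_zero] at h0
      simp [h0, hw0, mul_comm]
  -- The threshold `n₁` depends on l and may exceed n.
  obtain ⟨n₁, hn₁⟩ := Filter.eventually_atTop.mp (eventually_exists_sub_mul_mem hℓhom hne)
  obtain ⟨v, hv⟩ := hl.exists_hasEigenvector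
  obtain ⟨hv1, hv0⟩ := Module.End.hasEigenvector_iff.mp hv
  rw [Module.End.mem_eigenspace_iff, Matrix.toLin'_apply] at hv1
  obtain ⟨q, hq, rfl⟩ := exists_coordVec_eq h₀ v
  rw [mulMatrix_mulVec j h₀ h₁ hq] at hv1
  have hqhom := (mem_standardForms_iff.mp hq).1
  have hX : ∀ i : Fin N, (X i * q).IsHomogeneous (n + 1) := fun i => by
    rw [add_comm]
    exact (isHomogeneous_X ℂ i).mul hqhom
  have hXq := X_zero_mul_mem_standardForms (hs n hn) hq
  have hnp : normalPart I (n + 1) (X j * q) = l • (X 0 * q) := by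
    refine coordVec_injOn h₁ (normalPart_mem_standardForms I _ _)
      (Submodule.smul_mem _ l hXq) (hv1.trans ?_)
    funext i
    rw [Pi.smul_apply, coordVec, coordVec, coeff_smul,
      listedExponent_succ (hs n hn) h₀ h₁ (Nat.zero_le _), add_comm, coeff_X_mul]
  have hmem : ℓ * q ∈ initialForms I (n + 1) := by
    have := sub_normalPart_mem I (hX j)
    rw [hnp, smul_eq_C_mul, ← mul_assoc, ← sub_mul] at this
    exact this
  have hpow : ∀ k, X 0 ^ k * q ∈ standardForms I (n + k) := by
    intro k
    induction k with
    | zero => simpa using hq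
    | succ k ih =>
      rw [pow_succ', mul_assoc, ← add_assoc]
      exact X_zero_mul_mem_standardForms (hs (n + k) (by omega)) ih
  -- Multiplying q by z_1^n₁ reaches degree n + n₁, where injectivity is available; the product is
  -- still a standard form. This keeps the bound on n independent of l.
  have hzero : X 0 ^ n₁ * q = 0 := by
    refine eq_zero_of_mul_mem_initialForms hℓhom ?_ (hn₁ (n + n₁) (by omega)) (hpow n₁) ?_
    · rw [hd _ (by omega), hd _ (by omega)]
    · have := mul_mem_initialForms (isHomogeneous_X_pow (R := ℂ) (0 : Fin N) n₁) hmem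
      rwa [mul_left_comm, ← add_assoc, add_comm n₁ n] at this
  rcases mul_eq_zero.mp hzero with h | h
  · exact pow_ne_zero _ (X_ne_zero 0) h
  · refine hv0 ?_
    rw [h]
    funext i
    simp [coordVec]

theorem det_mulMatrix_ne_zero {N : ℕ} {I : Ideal (MvPolynomial (Fin N) ℂ)} {j : Fin N} {n d : ℕ}
    (h₀ : (standardExponentsOfDegree I n).card = d)
    (h₁ : (standardExponentsOfDegree I (n + 1)).card = d)
    (h : ∀ f : MvPolynomial (Fin N) ℂ, f.IsHomogeneous (n + 1) →
      ∃ g : MvPolynomial (Fin N) ℂ, g.IsHomogeneous n ∧ f - X j * g ∈ initialForms I (n + 1)) :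
    (mulMatrix I j n h₀ h₁).det ≠ 0 := by
  intro hdet
  obtain ⟨v, hv, hMv⟩ := Matrix.exists_mulVec_eq_zero_iff.mpr hdet
  obtain ⟨q, hq, rfl⟩ := exists_coordVec_eq h₀ v
  rw [mulMatrix_mulVec j h₀ h₁ hq] at hMv
  have hXq : (X j * q).IsHomogeneous (n + 1) := by
    rw [add_comm]
    exact (isHomogeneous_X ℂ j).mul (mem_standardForms_iff.mp hq).1
  have h0 : normalPart I (n + 1) (X j * q) = 0 :=
    coordVec_injOn h₁ (normalPart_mem_standardForms I _ _) (zero_mem _) (hMv.trans (by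
      funext i
      simp [coordVec]))
  refine hv ?_
  rw [eq_zero_of_mul_mem_initialForms (isHomogeneous_X ℂ j) (h₀.trans h₁.symm) h hq
    ((normalPart_eq_zero_iff hXq).mp h0)]
  funext i
  simp [coordVec]

end CurveComputation

end

/-! ### Assembly of the three statements -/

open CurveComputation in
theorem mainTheorem10 {N : ℕ} [NeZero N] (V : Set (Fin N → ℂ))
    (hV : CurveComputation.IsAlgebraicCurve V) :
    ∃ d : ℕ, 0 < d ∧ ∀ᶠ n : ℕ in Filter.atTop,
      ∃ (h₀ : (CurveComputation.standardExponentsOfDegree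
              (CurveComputation.idealOf V) n).card = d)
        (h₁ : (CurveComputation.standardExponentsOfDegree
              (CurveComputation.idealOf V) (n + 1)).card = d),
        -- a point `[0 : 1 : λ_2 : ⋯ : λ_N]` of the curve yields the eigenvalue `λ_j` of `[[z_j]]`
        (∀ j : Fin N, j ≠ 0 → ∀ l : ℂ,
          (∃ (w : Fin N → ℂ) (hw : w ≠ 0), w 0 = 1 ∧
            CurveComputation.pointAtInfinity w hw ∈ CurveComputation.projClosure V ∧ w j = l) →
          Module.End.HasEigenvalue
            (Matrix.toLin' (CurveComputation.mulMatrix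
              (CurveComputation.idealOf V) j n h₀ h₁)) l) ∧
        -- if no point at infinity of the curve has `z_1 = 0`, this is an equivalence
        ((∀ (w : Fin N → ℂ) (hw : w ≠ 0),
            CurveComputation.pointAtInfinity w hw ∈ CurveComputation.projClosure V → w 0 ≠ 0) →
          ∀ j : Fin N, j ≠ 0 → ∀ l : ℂ,
            (Module.End.HasEigenvalue
                (Matrix.toLin' (CurveComputation.mulMatrix
                  (CurveComputation.idealOf V) j n h₀ h₁)) l ↔
              ∃ (w : Fin N → ℂ) (hw : w ≠ 0), w 0 = 1 ∧
                CurveComputation.pointAtInfinity w hw ∈ CurveComputation.projClosure V ∧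
                w j = l)) ∧
        -- if no point at infinity of the curve has a zero coordinate, every `[[z_j]]` is nonsingular
        ((∀ (w : Fin N → ℂ) (hw : w ≠ 0),
            CurveComputation.pointAtInfinity w hw ∈ CurveComputation.projClosure V →
              ∀ j : Fin N, w j ≠ 0) →
          ∀ j : Fin N,
            (CurveComputation.mulMatrix (CurveComputation.idealOf V) j n h₀ h₁).det ≠ 0) := by
  obtain ⟨d, hd0, hd⟩ := exists_card_standardExponentsOfDegree hV
  refine ⟨d, hd0, ?_⟩
  obtain ⟨K, hK⟩ := exists_eventually_stableAbove hd
  have hsurj : ∀ j : Fin N, (∀ (w : Fin N → ℂ) (hw : w ≠ 0),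
      pointAtInfinity w hw ∈ projClosure V → w j ≠ 0) →
      ∀ᶠ n : ℕ in Filter.atTop, ∀ f : MvPolynomial (Fin N) ℂ, f.IsHomogeneous (n + 1) →
        ∃ g : MvPolynomial (Fin N) ℂ, g.IsHomogeneous n ∧
          f - X j * g ∈ initialForms (idealOf V) (n + 1) := by
    intro j hj
    refine eventually_exists_sub_mul_mem (isHomogeneous_X ℂ j) fun w hw hwI => ?_
    rw [eval_X]
    exact hj w hw ((pointAtInfinity_mem_projClosure_iff V w hw).mpr hwI)
  have hpart2 : (∀ (w : Fin N → ℂ) (hw : w ≠ 0),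
      pointAtInfinity w hw ∈ projClosure V → w 0 ≠ 0) →
      ∃ n₀ : ℕ, ∀ n, n₀ ≤ n → (standardExponentsOfDegree (idealOf V) n).card = d ∧
        StableAbove (idealOf V) 0 n := by
    intro h
    obtain ⟨n₀, hn₀⟩ := Filter.eventually_atTop.mp (hd.and (hsurj 0 h))
    refine ⟨n₀, fun n hn => ⟨(hn₀ n hn).1, stableAbove_zero ?_ (hn₀ n hn).2⟩⟩
    rw [(hn₀ n hn).1, (hn₀ (n + 1) (by omega)).1]
  -- The condition on points at infinity does not involve n, so it can be moved inside the
  -- quantifier over large n, as the conclusion requires.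
  have hlarge2 : ∀ᶠ n : ℕ in Filter.atTop, (∀ (w : Fin N → ℂ) (hw : w ≠ 0),
      pointAtInfinity w hw ∈ projClosure V → w 0 ≠ 0) →
      ∃ n₀ ≤ n, ∀ n, n₀ ≤ n → (standardExponentsOfDegree (idealOf V) n).card = d ∧
        StableAbove (idealOf V) 0 n := by
    rw [Filter.eventually_imp_distrib_left]
    intro h
    obtain ⟨n₀, hn₀⟩ := hpart2 h
    filter_upwards [Filter.eventually_ge_atTop n₀] with n hn
    exact ⟨n₀, hn, hn₀⟩
  have hlarge3 : ∀ᶠ n : ℕ in Filter.atTop, ∀ j : Fin N, (∀ (w : Fin N → ℂ) (hw : w ≠ 0),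
      pointAtInfinity w hw ∈ projClosure V → w j ≠ 0) →
      ∀ f : MvPolynomial (Fin N) ℂ, f.IsHomogeneous (n + 1) →
        ∃ g : MvPolynomial (Fin N) ℂ, g.IsHomogeneous n ∧
          f - X j * g ∈ initialForms (idealOf V) (n + 1) := by
    -- There are finitely many indices j, so one threshold serves them all.
    rw [Filter.eventually_all]
    intro j
    rw [Filter.eventually_imp_distrib_left]
    exact hsurj j
  filter_upwards [hd, (Filter.tendsto_add_atTop_nat 1).eventually hd, hK,
    Filter.eventually_ge_atTop K, hlarge2, hlarge3] with n h₀ h₁ hs hKn h2 h3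
  have hpoint : ∀ (j : Fin N) (l : ℂ), (∃ (w : Fin N → ℂ) (hw : w ≠ 0), w 0 = 1 ∧
      pointAtInfinity w hw ∈ projClosure V ∧ w j = l) →
      Module.End.HasEigenvalue (Matrix.toLin' (mulMatrix (idealOf V) j n h₀ h₁)) l := by
    rintro j _ ⟨w, hw, hw0, hwV, rfl⟩
    exact hasEigenvalue_of_point hs hKn h₀ h₁
      ((pointAtInfinity_mem_projClosure_iff V w hw).mp hwV) hw0 j
  refine ⟨h₀, h₁, fun j _ l => hpoint j l, fun hinf j _ l => ⟨fun hl => ?_, hpoint j l⟩,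
    fun hinf j => det_mulMatrix_ne_zero h₀ h₁ (h3 j fun w hw hwV => hinf w hw hwV j)⟩
  obtain ⟨n₀, hn, hn₀⟩ := h2 hinf
  obtain ⟨w, hw0, hwI, hwj⟩ := exists_point_of_hasEigenvalue (fun m hm => (hn₀ m hm).1)
    (fun m hm => (hn₀ m hm).2)
    (fun w hw hwI => hinf w hw ((pointAtInfinity_mem_projClosure_iff V w hw).mpr hwI))
    j hn h₀ h₁ hl
  have hw : w ≠ 0 := by
    rintro rfl
    exact zero_ne_one hw0
  exact ⟨w, hw, hw0, (pointAtInfinity_mem_projClosure_iff V w hw).mpr hwI, hwj⟩
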